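/- Let $t:\mathbb N\to\mathbb N$ be a superlinear ($n=o(t(n))$), time-constructible function ($1^n\mapsto 1^{t(n)}$ is computable by a multitape Turing machine in $O(t(n))$ steps). A martingale is a function $d:\{0,1\}^*\to[0,\infty)$ with $d(\lambda)=1$ for the empty string $\lambda$ and $d(w)=\tfrac12\,(d(w0)+d(w1))$ for all strings $w$. It succeeds on $X\in\{0,1\}^{\mathbb N}$ if $\limsup_{n\to\infty}d(X_0\dots X_{n-1})=\infty$. It is $t$-bounded if a multitape Turing machine computes the exact (rational) value $d(w)$ on input $w$, as a numerator and a denominator in binary, in $O(t(|w|))$ steps. It is $t^Y$-bounded, for $Y\in\{0,1\}^{\mathbb N}$, if this is done by a multitape Turing machine with oracle $Y$, which obtains the bit $Y_i$ in one step once the index $i$ is written in binary on its query tape. A sequence $X$ is $t$-random if no $t$-bounded martingale succeeds on $X$ (and $t$-nonrandom otherwise), and $t^Y$-random if no $t^Y$-bounded martingale succeeds on $X$. For $A,B\in\{0,1\}^{\mathbb N}$ let $A\uplus B=A_0B_0A_1B_1\dots$. Then there are sequences $A,B\in\{0,1\}^{\mathbb N}$ such that $B$ is $t$-random, $A$ is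 $t^B$-random, and $A\uplus B$ is $t$-nonrandom. -/

import Mathlib

open Filter
open scoped NNReal ENNReal

noncomputable section

namespace TimeBounded

/-- Infinite binary sequences. -/
abbrev BinSeq : Type := ℕ → Bool

/-- The prefix `X ↾ n = X₀ X₁ … X_{n-1}`. -/
def pre (X : BinSeq) (n : ℕ) : List Bool := List.ofFn fun i : Fin n => X i

/-- The interleaving `A ⊎ B = A₀ B₀ A₁ B₁ …`. -/
def interleave (A B : BinSeq) : BinSeq :=
  fun n => if n % 2 = 0 then A (n / 2) else B (n / 2)

/-! ### Oracle Turing machines with several tapes -/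

/-- The tapes of a machine: an input tape, a query tape, two output tapes (for the numerator and
the denominator of a rational number) and `k` work tapes. -/
inductive TapeName (k : ℕ) : Type
  | input : TapeName k
  | query : TapeName k
  | numer : TapeName k
  | denom : TapeName k
  | work (i : Fin k) : TapeName k

/-- A two-way infinite tape over the alphabet `{0, 1, blank}`; `none` is the blank symbol. -/
abbrev TapeContent : Type := ℤ → Option Bool

/-- The tape carrying the word `w` in the cells `0, …, |w| - 1`, blank elsewhere. -/
def tapeOf (w : List Bool) : TapeContent :=
  fun i => if 0 ≤ i then w[i.toNat]? else none

/-- The length of the block of nonblank cells that starts at cell `0`. (In every configuration that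
a computation reaches, only finitely many cells are nonblank.) -/
def blockLength (T : TapeContent) : ℕ := sInf {n : ℕ | T (n : ℤ) = none}

/-- The natural number written in binary, least significant digit first, in the block of nonblank
cells that starts at cell `0`. -/
def binaryValue (T : TapeContent) : ℕ :=
  ∑ i ∈ Finset.range (blockLength T), if T (i : ℤ) = some true then 2 ^ i else 0

/-- What a machine does in one step: halt; or ask the oracle for the bit whose index is written in
binary on the query tape and enter a state that depends on the answer; or enter a new state, write
a symbol on every tape and move every head by `-1`, `0` or `1` cells. -/
inductive Action (k : ℕ) (Q : Type) : Type
  | halt : Action k Q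
  | ask (next : Bool → Q) : Action k Q
  | act (next : Q) (op : TapeName k → Option Bool × SignType) : Action k Q

/-- A deterministic oracle Turing machine with finitely many states. The action depends on the state
and on the symbols under the heads. -/
structure Machine where
  k : ℕ
  Q : Type
  finite_states : Finite Q
  start : Q
  δ : Q → (TapeName k → Option Bool) → Action k Q

/-- A configuration: the state, the contents of the tapes and the positions of the heads. -/
structure Config (M : Machine) where
  state : M.Q
  tape : TapeName M.k → TapeContent
  head : TapeName M.k → ℤ

namespace Machine

/-- The action that the machine takes in a given configuration. -/
def action (M : Machine) (c : Config M) : Action M.k M.Q :=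
  M.δ c.state fun j => c.tape j (c.head j)

/-- One step with oracle `Z`; a halting configuration does not change any more. -/
def step (M : Machine) (Z : BinSeq) (c : Config M) : Config M :=
  match M.action c with
  | .halt => c
  | .ask next => { c with state := next (Z (binaryValue (c.tape .query))) }
  | .act next op =>
      { state := next
        tape := fun j => Function.update (c.tape j) (c.head j) (op j).1
        head := fun j => c.head j + ((op j).2 : ℤ) }

/-- The initial configuration on input `w`: the input tape carries `w`, all other tapes are blank,
and all heads are on cell `0`. -/
def init (M : Machine) (w : List Bool) : Config M where
  state := M.start
  tape := fun j => match j with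
    | .input => tapeOf w
    | _ => fun _ => none
  head := fun _ => 0

/-- The configuration after `T` steps on input `w` with oracle `Z`. -/
def run (M : Machine) (Z : BinSeq) (w : List Bool) (T : ℕ) : Config M :=
  (M.step Z)^[T] (M.init w)

def Halted (M : Machine) (c : Config M) : Prop := M.action c = .halt

/-- The machine never asks its oracle: it is an ordinary Turing machine. -/
def OracleFree (M : Machine) : Prop :=
  ∀ (q : M.Q) (s : TapeName M.k → Option Bool) (next : Bool → M.Q), M.δ q s ≠ .ask next

/-- On input `w` with oracle `Z`, the machine halts within `T` steps, with the numerator and the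
(nonzero) denominator of a fraction that represents `r` on its output tapes. -/
def OutputsWithin (M : Machine) (Z : BinSeq) (w : List Bool) (T : ℕ) (r : ℝ≥0) : Prop :=
  M.Halted (M.run Z w T) ∧
    binaryValue ((M.run Z w T).tape .denom) ≠ 0 ∧
    r = (binaryValue ((M.run Z w T).tape .numer) : ℝ≥0) /
      (binaryValue ((M.run Z w T).tape .denom) : ℝ≥0)

end Machine

/-- `t` is time-constructible: some Turing machine without oracle maps `1ⁿ` to `1^{t(n)}` in
`O(t(n))` steps. -/
def TimeConstructible (t : ℕ → ℕ) : Prop :=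
  ∃ M : Machine, M.OracleFree ∧ ∃ C : ℕ, ∀ (n : ℕ) (Z : BinSeq),
    M.Halted (M.run Z (List.replicate n true) (C * t n + C)) ∧
    (M.run Z (List.replicate n true) (C * t n + C)).tape .numer =
      tapeOf (List.replicate (t n) true)

/-- `t` is superlinear: `n = o(t(n))`. -/
def Superlinear (t : ℕ → ℕ) : Prop :=
  (fun n : ℕ => (n : ℝ)) =o[atTop] (fun n : ℕ => (t n : ℝ))

/-! ### Martingales -/

/-- A martingale on binary strings. -/
def IsMartingale (d : List Bool → ℝ≥0) : Prop :=
  d [] = 1 ∧ ∀ w : List Bool, d w = (d (w ++ [false]) + d (w ++ [true])) / 2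

/-- The martingale `d` succeeds on `X`. -/
def Succeeds (d : List Bool → ℝ≥0) (X : BinSeq) : Prop :=
  limsup (fun n : ℕ => (d (pre X n) : ℝ≥0∞)) atTop = ⊤

/-- `d` is a `t`-bounded martingale: its exact values are computed by a Turing machine without
oracle in `O(t(|w|))` steps. -/
def IsBoundedMartingale (t : ℕ → ℕ) (d : List Bool → ℝ≥0) : Prop :=
  IsMartingale d ∧ ∃ M : Machine, M.OracleFree ∧ ∃ C : ℕ, ∀ (w : List Bool) (Z : BinSeq),
    M.OutputsWithin Z w (C * t w.length + C) (d w)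

/-- `d` is a `t^Y`-bounded martingale: its exact values are computed by an oracle Turing machine
with oracle `Y` in `O(t(|w|))` steps. Nothing is required of the machine for other oracles. -/
def IsBoundedMartingaleRel (t : ℕ → ℕ) (Y : BinSeq) (d : List Bool → ℝ≥0) : Prop :=
  IsMartingale d ∧ ∃ M : Machine, ∃ C : ℕ, ∀ w : List Bool,
    M.OutputsWithin Y w (C * t w.length + C) (d w)

/-- `X` is `t`-random. -/
def IsRandom (t : ℕ → ℕ) (X : BinSeq) : Prop :=
  ¬ ∃ d : List Bool → ℝ≥0, IsBoundedMartingale t d ∧ Succeeds d X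

/-- `X` is `t^Y`-random, that is, `t`-random with respect to `Y`. -/
def IsRandomRel (t : ℕ → ℕ) (Y X : BinSeq) : Prop :=
  ¬ ∃ d : List Bool → ℝ≥0, IsBoundedMartingaleRel t Y d ∧ Succeeds d X

end TimeBounded

end

/-!
Only countably many martingales compete, so one sequence defeats them all: bet by bet, choose the
bit on which a weighted average of their capitals does not increase. Take `B = Y` and `A = Y ∘ b`
with `b` strictly increasing, so sparse that, for every `C`, eventually `2 ^ (C * t n + C) ≤ b i`
for all `n ≤ i + 1`. A machine that computes a `t^B`-bounded martingale on `A_0 … A_i` has no time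
to write the index `b i` on its query tape, so it learns only about bits of `Y` before the position
`b i` of `A_i`. Hence its bets on `A` are fair bets on the bits of `Y` at the positions `b i`, and
they are among the countably many strategies that `Y` defeats.

On the other hand, `A_i = B_p` for `p = b i`. Let `b` be given by the ticks of a clock, a Turing
machine which runs in real time and ticks at least that sparsely; time-constructibility of the time
bound provides one. When betting on the `p`-th pair of bits of `A ⊎ B`, a machine that has run this
clock for one step per pair knows whether `p = b i`, and its number of ticks tells where `A_i` is,
so that in linear time it computes a martingale that doubles its capital at every `p = b i`.
-/

noncomputable section

namespace TimeBounded

/-! ### Countably many martingales -/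

section Martingales

variable {d : List Bool → ℝ≥0} {X : BinSeq}

@[simp] theorem pre_zero (X : BinSeq) : pre X 0 = [] := List.ofFn_zero

theorem pre_succ (X : BinSeq) (n : ℕ) : pre X (n + 1) = pre X n ++ [X n] :=
  List.ofFn_succ_last

@[simp] theorem length_pre (X : BinSeq) (n : ℕ) : (pre X n).length = n := List.length_ofFn

theorem getD_pre (X : BinSeq) {i n : ℕ} (h : i < n) : (pre X n).getD i false = X i := by
  simp [pre, List.getD_eq_getElem?_getD, h]

theorem not_succeeds_of_eventually_le {K : ℝ≥0} (h : ∀ᶠ n in atTop, d (pre X n) ≤ K) :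
    ¬ Succeeds d X := by
  intro hs
  have hfreq : ∃ᶠ n in atTop, (K : ℝ≥0∞) < d (pre X n) :=
    frequently_lt_of_lt_limsup (by isBoundedDefault) (by
      rw [hs]
      exact ENNReal.coe_lt_top)
  refine hfreq (h.mono fun n hn => not_lt.2 ?_)
  exact_mod_cast hn

theorem succeeds_of_tendsto {φ : ℕ → ℕ} (hφ : Tendsto φ atTop atTop)
    (h : Tendsto (fun n => d (pre X (φ n))) atTop atTop) : Succeeds d X := by
  refine ENNReal.eq_top_of_forall_nnreal_le fun K => le_limsup_of_frequently_le ?_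
  refine hφ.frequently (((h.eventually_ge_atTop K).mono fun n hn => ?_).frequently)
  exact_mod_cast hn

namespace IsMartingale

theorem append_add_append (hd : IsMartingale d) (w : List Bool) :
    d (w ++ [false]) + d (w ++ [true]) = 2 * d w := by
  rw [hd.2 w, mul_div_cancel₀ _ two_ne_zero]

theorem append_le (hd : IsMartingale d) (w : List Bool) (a : Bool) : d (w ++ [a]) ≤ 2 * d w := by
  rw [← hd.append_add_append w]
  cases a
  · exact le_self_add
  · exact le_add_self

theorem le_two_pow (hd : IsMartingale d) (w : List Bool) : d w ≤ 2 ^ w.length := by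
  induction w using List.reverseRecOn with
  | nil => simp [hd.1]
  | append_singleton w a ih =>
    calc d (w ++ [a]) ≤ 2 * d w := hd.append_le w a
      _ ≤ 2 * 2 ^ w.length := by gcongr
      _ = 2 ^ (w ++ [a]).length := by rw [List.length_append, List.length_singleton, pow_succ']

theorem summable_mul {ι : Type*} {F : ι → List Bool → ℝ≥0} {c : ι → ℝ≥0} (hc : Summable c)
    (hF : ∀ i, IsMartingale (F i)) (w : List Bool) : Summable fun i => c i * F i w :=
  NNReal.summable_of_le (fun i => mul_le_mul_right ((hF i).le_two_pow w) (c i))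
    (hc.mul_right (2 ^ w.length))

theorem tsum_mul_append_add_append {ι : Type*} {F : ι → List Bool → ℝ≥0} {c : ι → ℝ≥0}
    (hc : Summable c) (hF : ∀ i, IsMartingale (F i)) (w : List Bool) :
    ∑' i, c i * F i (w ++ [false]) + ∑' i, c i * F i (w ++ [true]) = 2 * ∑' i, c i * F i w := by
  rw [← (summable_mul hc hF _).tsum_add (summable_mul hc hF _), ← NNReal.tsum_mul_left]
  refine tsum_congr fun i => ?_
  rw [← mul_add, (hF i).append_add_append, mul_left_comm]

end IsMartingale

theorem exists_antitone_pre {α : Type*} [Preorder α] {S : List Bool → α}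
    (hS : ∀ w, ∃ a, S (w ++ [a]) ≤ S w) : ∃ X : BinSeq, Antitone fun n => S (pre X n) := by
  choose a ha using hS
  let W : ℕ → List Bool := fun n => Nat.rec [] (fun _ w => w ++ [a w]) n
  have hpre : ∀ n, pre (fun n => a (W n)) n = W n := fun n => by
    induction n with
    | zero => rfl
    | succ n ih => rw [pre_succ, ih]
  refine ⟨fun n => a (W n), antitone_nat_of_succ_le fun n => ?_⟩
  rw [hpre, hpre]
  exact ha (W n)

theorem exists_forall_mem_bounded {S : Set (List Bool → ℝ≥0)} (hS : S.Countable)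
    (hmart : ∀ d ∈ S, IsMartingale d) :
    ∃ X : BinSeq, ∀ d ∈ S, ∃ K : ℝ≥0, ∀ n, d (pre X n) ≤ K := by
  have := hS.to_subtype
  obtain ⟨c, hpos, _, hsum, -⟩ := NNReal.exists_pos_sum_of_countable one_ne_zero S
  let mix : List Bool → ℝ≥0 := fun w => ∑' d : S, c d * d.1 w
  have hmix : ∀ w, ∃ a, mix (w ++ [a]) ≤ mix w := fun w => by
    by_contra! h
    refine (add_lt_add (h false) (h true)).ne' ?_
    rw [← two_mul]
    exact IsMartingale.tsum_mul_append_add_append hsum.summable (fun d : S => hmart d d.2) w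
  obtain ⟨X, hX⟩ := exists_antitone_pre hmix
  refine ⟨X, fun d hd => ⟨(c ⟨d, hd⟩)⁻¹ * mix [], fun n => ?_⟩⟩
  rw [← div_eq_inv_mul, le_div_iff₀' (hpos _)]
  calc c ⟨d, hd⟩ * d (pre X n) ≤ mix (pre X n) :=
        (IsMartingale.summable_mul hsum.summable (fun d : S => hmart d d.2) _).le_tsum ⟨d, hd⟩
          fun _ _ => zero_le
    _ ≤ mix [] := hX (Nat.zero_le n)

end Martingales

/-! ### Betting strategies -/

/-- A betting strategy given by the factor `ρ w a` by which the capital changes when the bit `a`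
follows the prefix `w` is fair if the mean of the two possible factors is `1`. -/
def IsFair (ρ : List Bool → Bool → ℝ≥0) : Prop := ∀ w, ρ w false + ρ w true = 2

/-- The capital that the betting strategy `ρ` has after `w` when it starts with capital `1`. -/
def capital (ρ : List Bool → Bool → ℝ≥0) (w : List Bool) : ℝ≥0 :=
  ∏ i ∈ Finset.range w.length, ρ (w.take i) (w.getD i false)

@[simp] theorem capital_nil (ρ : List Bool → Bool → ℝ≥0) : capital ρ [] = 1 := by
  simp [capital]

theorem capital_append (ρ : List Bool → Bool → ℝ≥0) (w : List Bool) (a : Bool) :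
    capital ρ (w ++ [a]) = capital ρ w * ρ w a := by
  rw [capital, List.length_append, List.length_singleton, Finset.prod_range_succ]
  congr 1
  · refine Finset.prod_congr rfl fun i hi => ?_
    have hi' := Finset.mem_range.1 hi
    rw [List.take_append_of_le_length hi'.le, List.getD_append _ _ _ _ hi']
  · simp

theorem IsFair.isMartingale_capital {ρ : List Bool → Bool → ℝ≥0} (hρ : IsFair ρ) :
    IsMartingale (capital ρ) := by
  refine ⟨capital_nil ρ, fun w => ?_⟩
  rw [capital_append, capital_append, ← mul_add, hρ w, mul_div_cancel_right₀ _ two_ne_zero]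

theorem capital_pre_eq_of_forall_eq_one {ρ : List Bool → Bool → ℝ≥0} {X : BinSeq} {m n : ℕ}
    (hmn : m ≤ n) (h : ∀ k, m ≤ k → k < n → ρ (pre X k) (X k) = 1) :
    capital ρ (pre X n) = capital ρ (pre X m) := by
  induction n, hmn using Nat.le_induction with
  | base => rfl
  | succ n hmn ih =>
    rw [pre_succ, capital_append, h n hmn n.lt_succ_self, mul_one,
      ih fun k hk hkn => h k hk (hkn.trans n.lt_succ_self)]

/-- The factor by which the capital `f` changes when the bit `a` follows `w`; it is replaced by `1`
where `f` does not describe a fair bet. -/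
def fairRatio (f : List Bool → ℝ≥0) (w : List Bool) (a : Bool) : ℝ≥0 :=
  if f w ≠ 0 ∧ f (w ++ [false]) + f (w ++ [true]) = 2 * f w then f (w ++ [a]) / f w else 1

theorem isFair_fairRatio (f : List Bool → ℝ≥0) : IsFair (fairRatio f) := by
  intro w
  unfold fairRatio
  split_ifs with h
  · rw [← add_div, h.2, mul_div_cancel_right₀ _ h.1]
  · exact one_add_one_eq_two

theorem fairRatio_congr {f g : List Bool → ℝ≥0} {w : List Bool} (h : f w = g w)
    (happend : ∀ a, f (w ++ [a]) = g (w ++ [a])) : fairRatio f w = fairRatio g w := by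
  funext a
  simp only [fairRatio, h, happend]

theorem IsMartingale.append_eq_mul_fairRatio {d : List Bool → ℝ≥0} (hd : IsMartingale d)
    (w : List Bool) (a : Bool) : d (w ++ [a]) = d w * fairRatio d w a := by
  by_cases h : d w = 0
  · rw [h, zero_mul]
    simpa [h] using hd.append_le w a
  · rw [fairRatio, if_pos ⟨h, hd.append_add_append w⟩, mul_div_cancel₀ _ h]

/-- The bits of `w` at the positions `b 0, …, b (n - 1)`. -/
def subword (b : ℕ → ℕ) (w : List Bool) (n : ℕ) : List Bool :=
  pre (fun i => w.getD (b i) false) n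

theorem subword_pre {b : ℕ → ℕ} {n m : ℕ} (h : ∀ i < n, b i < m) (X : BinSeq) :
    subword b (pre X m) n = pre (X ∘ b) n := by
  unfold subword pre
  congr 1
  funext i
  exact getD_pre X (h i i.2)

open Classical in
/-- The strategy that bets at the positions `b n` with `n₀ ≤ n` only; after `w` it treats the bit at
position `b n` like the `n`-th bit of the sequence of bits at the positions `b 0, b 1, …`, on which
it bets as `g w` does. Here `g w` is what can be said after `w` about a martingale that depends on
the whole sequence. -/
def transferRatio (b : ℕ → ℕ) (n₀ : ℕ) (g : List Bool → List Bool → ℝ≥0) (w : List Bool)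
    (a : Bool) : ℝ≥0 :=
  if h : ∃ n, n₀ ≤ n ∧ b n = w.length then fairRatio (g w) (subword b w h.choose) a else 1

section Transfer

variable {b : ℕ → ℕ} {n₀ n : ℕ} {g : List Bool → List Bool → ℝ≥0}

theorem isFair_transferRatio (b : ℕ → ℕ) (n₀ : ℕ) (g : List Bool → List Bool → ℝ≥0) :
    IsFair (transferRatio b n₀ g) := by
  intro w
  unfold transferRatio
  split_ifs
  · exact isFair_fairRatio _ _
  · exact one_add_one_eq_two

theorem transferRatio_of_length_eq (hb : b.Injective) (hn : n₀ ≤ n) {w : List Bool}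
    (hw : w.length = b n) (a : Bool) :
    transferRatio b n₀ g w a = fairRatio (g w) (subword b w n) a := by
  have hex : ∃ k, n₀ ≤ k ∧ b k = w.length := ⟨n, hn, hw.symm⟩
  have hchoose : hex.choose = n := hb (hex.choose_spec.2.trans hw)
  rw [transferRatio, dif_pos hex, hchoose]

theorem transferRatio_of_forall_ne {w : List Bool} (h : ∀ k, n₀ ≤ k → b k ≠ w.length) (a : Bool) :
    transferRatio b n₀ g w a = 1 :=
  dif_neg fun ⟨k, hk, hw⟩ => h k hk hw

theorem IsMartingale.pre_comp_eq_mul_capital_transferRatio {d : List Bool → ℝ≥0}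
    (hd : IsMartingale d) (hb : StrictMono b) {Y : BinSeq}
    (hg : ∀ k, n₀ ≤ k → ∀ u : List Bool, u.length ≤ k + 1 → g (pre Y (b k)) u = d u)
    (hn : n₀ ≤ n) :
    d (pre (Y ∘ b) n) =
      d (pre (Y ∘ b) n₀) * capital (transferRatio b n₀ g) (pre Y (b n)) := by
  induction n, hn using Nat.le_induction with
  | base =>
    have hidle : capital (transferRatio b n₀ g) (pre Y (b n₀)) = capital _ (pre Y 0) :=
      capital_pre_eq_of_forall_eq_one (Nat.zero_le _) fun k _ hk =>
        transferRatio_of_forall_ne (fun i hi => by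
          rw [length_pre]
          exact (hk.trans_le (hb.monotone hi)).ne') _
    rw [hidle, pre_zero, capital_nil, mul_one]
  | succ n hn ih =>
    have hidle : capital (transferRatio b n₀ g) (pre Y (b (n + 1))) =
        capital _ (pre Y (b n + 1)) :=
      capital_pre_eq_of_forall_eq_one (hb n.lt_succ_self) fun k hk hkn =>
        transferRatio_of_forall_ne (fun i _ hi => by
          rw [length_pre] at hi
          subst hi
          exact absurd (hb.lt_iff_lt.1 hkn) (Nat.not_lt.2 (hb.lt_iff_lt.1 hk))) _
    have hratio : transferRatio b n₀ g (pre Y (b n)) (Y (b n)) =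
        fairRatio d (pre (Y ∘ b) n) (Y (b n)) := by
      rw [transferRatio_of_length_eq hb.injective hn (length_pre _ _),
        subword_pre (fun i hi => hb hi),
        fairRatio_congr (hg n hn _ (by simp)) fun a => hg n hn _ (by simp)]
    rw [hidle, pre_succ Y, capital_append, hratio, ← mul_assoc, ← ih, pre_succ (Y ∘ b),
      hd.append_eq_mul_fairRatio, Function.comp_apply]

end Transfer

/-! ### Bounded computations -/

namespace Machine

variable {M : Machine} {Z : BinSeq} {w : List Bool} {c : Config M}

theorem run_succ (M : Machine) (Z : BinSeq) (w : List Bool) (T : ℕ) :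
    M.run Z w (T + 1) = M.step Z (M.run Z w T) :=
  Function.iterate_succ_apply' _ _ _

theorem step_of_halted (h : M.Halted c) : M.step Z c = c := by
  rw [step, h]

theorem step_of_ask {next : Bool → M.Q} (h : M.action c = .ask next) :
    M.step Z c = { c with state := next (Z (binaryValue (c.tape .query))) } := by
  rw [step, h]

theorem step_of_act {next : M.Q} {op : TapeName M.k → Option Bool × SignType}
    (h : M.action c = .act next op) :
    M.step Z c =
      { state := next
        tape := fun j => Function.update (c.tape j) (c.head j) (op j).1
        head := fun j => c.head j + ((op j).2 : ℤ) } := by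
  rw [step, h]

theorem run_of_halted {S T : ℕ} (h : M.Halted (M.run Z w S)) (hST : S ≤ T) :
    M.run Z w T = M.run Z w S := by
  induction T, hST using Nat.le_induction with
  | base => rfl
  | succ T _ ih => rw [run_succ, ih, step_of_halted h]

theorem OutputsWithin.mono {S T : ℕ} {r : ℝ≥0} (h : M.OutputsWithin Z w S r) (hST : S ≤ T) :
    M.OutputsWithin Z w T r := by
  rw [OutputsWithin, run_of_halted h.1 hST]
  exact h

theorem head_step_le (Z : BinSeq) (c : Config M) (j : TapeName M.k) :
    (M.step Z c).head j ≤ c.head j + 1 := by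
  cases h : M.action c with
  | halt => rw [step_of_halted h]; lia
  | ask next => rw [step_of_ask h]; lia
  | act next op =>
    have hop : ((op j).2 : ℤ) ≤ 1 := by cases (op j).2 <;> decide
    rw [step_of_act h]
    exact Int.add_le_add_left hop _

theorem tape_step_of_ne {j : TapeName M.k} {i : ℤ} (hi : i ≠ c.head j) :
    (M.step Z c).tape j i = c.tape j i := by
  cases h : M.action c with
  | halt => rw [step_of_halted h]
  | ask next => rw [step_of_ask h]
  | act next op => rw [step_of_act h]; exact Function.update_of_ne hi _ _

theorem head_run_le (M : Machine) (Z : BinSeq) (w : List Bool) (T : ℕ) (j : TapeName M.k) :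
    (M.run Z w T).head j ≤ T := by
  induction T with
  | zero => exact le_rfl
  | succ T ih =>
    rw [run_succ, Nat.cast_succ]
    exact (head_step_le Z _ j).trans (by gcongr)

theorem tape_run_of_le {T : ℕ} {i : ℤ} (hi : T ≤ i) (j : TapeName M.k) :
    (M.run Z w T).tape j i = (M.init w).tape j i := by
  induction T with
  | zero => rfl
  | succ T ih =>
    have hT : (T : ℤ) < i := by exact_mod_cast hi
    rw [run_succ, tape_step_of_ne ((M.head_run_le Z w T j).trans_lt hT).ne', ih hT.le]

end Machine

theorem blockLength_le {T : TapeContent} {n : ℕ} (h : T n = none) : blockLength T ≤ n :=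
  Nat.sInf_le h

theorem binaryValue_lt (T : TapeContent) : binaryValue T < 2 ^ blockLength T :=
  calc binaryValue T ≤ ∑ i ∈ Finset.range (blockLength T), 2 ^ i :=
        Finset.sum_le_sum fun i _ => by split <;> simp
    _ < 2 ^ blockLength T := by
        rw [Nat.geomSum_eq le_rfl, Nat.div_one]
        exact Nat.sub_one_lt (by positivity)

namespace Machine

theorem length_le_of_tape_numer_run_eq {M : Machine} {Z : BinSeq} {v w : List Bool} {T : ℕ}
    (h : (M.run Z w T).tape .numer = tapeOf v) : v.length ≤ T := by
  have hT := tape_run_of_le (Z := Z) (w := w) (le_refl (T : ℤ)) (.numer : TapeName M.k)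
  rw [h] at hT
  simpa [tapeOf, init] using hT

theorem binaryValue_query_run_lt (M : Machine) (Z : BinSeq) (w : List Bool) (T : ℕ) :
    binaryValue ((M.run Z w T).tape .query) < 2 ^ T :=
  (binaryValue_lt _).trans_le
    (Nat.pow_le_pow_right two_pos (blockLength_le (tape_run_of_le le_rfl _)))

theorem run_congr (M : Machine) {Z Z' : BinSeq} (w : List Bool) {T : ℕ}
    (h : ∀ i < 2 ^ T, Z i = Z' i) : M.run Z w T = M.run Z' w T := by
  induction T with
  | zero => rfl
  | succ T ih =>
    have hT : 2 ^ T < 2 ^ (T + 1) := Nat.pow_lt_pow_right one_lt_two T.lt_succ_self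
    rw [run_succ, run_succ, ← ih fun i hi => h i (hi.trans hT)]
    cases ha : M.action (M.run Z w T) with
    | halt => rw [step_of_halted ha, step_of_halted ha]
    | ask next =>
      rw [step_of_ask ha, step_of_ask ha, h _ ((M.binaryValue_query_run_lt Z w T).trans hT)]
    | act next op => rw [step_of_act ha, step_of_act ha]

/-- The fraction on the output tapes after `T` steps; it is `0` if the denominator is `0`. -/
def value (M : Machine) (Z : BinSeq) (w : List Bool) (T : ℕ) : ℝ≥0 :=
  binaryValue ((M.run Z w T).tape .numer) / binaryValue ((M.run Z w T).tape .denom)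

theorem value_congr (M : Machine) {Z Z' : BinSeq} (w : List Bool) {T : ℕ}
    (h : ∀ i < 2 ^ T, Z i = Z' i) : M.value Z w T = M.value Z' w T := by
  rw [value, value, M.run_congr w h]

end Machine

/-! ### Countably many machines -/

instance (k : ℕ) : Finite (TapeName k) :=
  Finite.of_surjective (Sum.elim ![.input, .query, .numer, .denom] .work : Fin 4 ⊕ Fin k → _)
    fun
    | .input => ⟨.inl 0, rfl⟩
    | .query => ⟨.inl 1, rfl⟩
    | .numer => ⟨.inl 2, rfl⟩
    | .denom => ⟨.inl 3, rfl⟩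
    | .work i => ⟨.inr i, rfl⟩

instance {k : ℕ} {Q : Type} [Finite Q] : Countable (Action k Q) :=
  Function.Surjective.countable
    (f := fun a : Option ((Bool → Q) ⊕ Q × (TapeName k → Option Bool × SignType)) =>
      match a with
      | none => .halt
      | some (.inl next) => .ask next
      | some (.inr (next, op)) => .act next op)
    fun
    | .halt => ⟨none, rfl⟩
    | .ask next => ⟨some (.inl next), rfl⟩
    | .act next op => ⟨some (.inr (next, op)), rfl⟩

/-- A machine with state set `Fin q`, given by the number of its work tapes, `q`, the initial state
and the transition table. Unlike `Machine`, this is a countable type. -/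
abbrev MachineTable : Type :=
  Σ k q : ℕ, Fin q × (Fin q → (TapeName k → Option Bool) → Action k (Fin q))

/-- The machine described by a table. -/
def MachineTable.toMachine (m : MachineTable) : Machine where
  k := m.1
  Q := Fin m.2.1
  finite_states := inferInstance
  start := m.2.2.1
  δ := m.2.2.2

/-- Renaming of the states in an action. -/
def Action.map {k : ℕ} {Q Q' : Type} (e : Q → Q') : Action k Q → Action k Q'
  | .halt => .halt
  | .ask next => .ask (e ∘ next)
  | .act next op => .act (e next) op

namespace Machine

/-- The table of a machine whose states are numbered by `e`. -/
def table (M : Machine) {q : ℕ} (e : M.Q ≃ Fin q) : MachineTable :=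
  ⟨M.k, q, e M.start, fun s r => (M.δ (e.symm s) r).map e⟩

theorem run_table (M : Machine) {q : ℕ} (e : M.Q ≃ Fin q) (Z : BinSeq) (w : List Bool) (T : ℕ) :
    (M.table e).toMachine.run Z w T =
      { state := e (M.run Z w T).state
        tape := (M.run Z w T).tape
        head := (M.run Z w T).head } := by
  induction T with
  | zero =>
    have hinit : ((M.table e).toMachine.init w).tape = (M.init w).tape :=
      funext fun j => by cases j <;> rfl
    exact congrArg (Config.mk (e M.start) · fun _ => 0) hinit
  | succ T ih =>
    rw [run_succ, run_succ, ih]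
    generalize M.run Z w T = c
    have haction : (M.table e).toMachine.action ⟨e c.state, c.tape, c.head⟩ =
        (M.action c).map e :=
      congrArg (fun s => (M.δ s _).map e) (e.symm_apply_apply c.state)
    cases h : M.action c <;> rw [h] at haction
    case halt => rw [step_of_halted haction, step_of_halted h]
    case ask => rw [step_of_ask haction, step_of_ask h]; rfl
    case act => rw [step_of_act haction, step_of_act h]; rfl

theorem exists_table (M : Machine) : ∃ m : MachineTable, m.toMachine.value = M.value := by
  obtain ⟨q, ⟨e⟩⟩ := M.finite_states.exists_equiv_fin
  refine ⟨M.table e, ?_⟩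
  funext Z w T
  rw [value, value, run_table]
  rfl

end Machine

section Countability

variable {t : ℕ → ℕ} {d : List Bool → ℝ≥0}

theorem IsBoundedMartingale.rel (h : IsBoundedMartingale t d) (Y : BinSeq) :
    IsBoundedMartingaleRel t Y d :=
  let ⟨hd, M, _, C, hM⟩ := h
  ⟨hd, M, C, fun w => hM w Y⟩

theorem IsBoundedMartingaleRel.exists_value_eq {Y : BinSeq} (h : IsBoundedMartingaleRel t Y d) :
    ∃ (m : MachineTable) (C : ℕ), ∀ w, m.toMachine.value Y w (C * t w.length + C) = d w := by
  obtain ⟨-, M, C, hM⟩ := h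
  obtain ⟨m, hm⟩ := M.exists_table
  exact ⟨m, C, fun w => by rw [hm]; exact (hM w).2.2.symm⟩

theorem countable_setOf_isBoundedMartingaleRel (t : ℕ → ℕ) (Y : BinSeq) :
    {d | IsBoundedMartingaleRel t Y d}.Countable := by
  refine (Set.countable_range fun (p : MachineTable × ℕ) w =>
    p.1.toMachine.value Y w (p.2 * t w.length + p.2)).mono fun d hd => ?_
  obtain ⟨m, C, hm⟩ := hd.exists_value_eq
  exact ⟨(m, C), funext hm⟩

end Countability

/-! ### A random sequence with a relatively random subsequence -/

theorem exists_isRandom_isRandomRel_comp {t b : ℕ → ℕ} (hb : StrictMono b)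
    (hgrow : ∀ C, ∀ᶠ i in atTop, ∀ n ≤ i + 1, 2 ^ (C * t n + C) ≤ b i) :
    ∃ Y : BinSeq, IsRandom t Y ∧ IsRandomRel t Y (Y ∘ b) := by
  choose n₀ hn₀ using fun C => eventually_atTop.1 (hgrow C)
  let guess (p : MachineTable × ℕ) (v u : List Bool) : ℝ≥0 :=
    p.1.toMachine.value (fun i => v.getD i false) u (p.2 * t u.length + p.2)
  let transfer (p : MachineTable × ℕ) : List Bool → ℝ≥0 :=
    capital (transferRatio b (n₀ p.2) (guess p))
  obtain ⟨Y, hY⟩ := exists_forall_mem_bounded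
    (S := {d | IsBoundedMartingaleRel t (fun _ => false) d} ∪ Set.range transfer)
    ((countable_setOf_isBoundedMartingaleRel _ _).union (Set.countable_range _)) (by
      rintro d (hd | ⟨p, rfl⟩)
      · exact hd.1
      · exact (isFair_transferRatio b (n₀ p.2) (guess p)).isMartingale_capital)
  refine ⟨Y, ?_, ?_⟩
  · rintro ⟨d, hd, hs⟩
    obtain ⟨K, hK⟩ := hY d (.inl (hd.rel _))
    exact not_succeeds_of_eventually_le (.of_forall hK) hs
  · rintro ⟨d, hd, hs⟩
    obtain ⟨m, C, hm⟩ := hd.exists_value_eq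
    obtain ⟨K, hK⟩ := hY _ (.inr ⟨(m, C), rfl⟩)
    have hguess : ∀ k, n₀ C ≤ k → ∀ u : List Bool, u.length ≤ k + 1 →
        guess (m, C) (pre Y (b k)) u = d u := fun k hk u hu => by
      rw [← hm u]
      exact Machine.value_congr _ u fun i hi => getD_pre Y (hi.trans_le (hn₀ C k hk _ hu))
    refine not_succeeds_of_eventually_le (K := d (pre (Y ∘ b) (n₀ C)) * K) ?_ hs
    filter_upwards [eventually_ge_atTop (n₀ C)] with n hn
    rw [hd.1.pre_comp_eq_mul_capital_transferRatio hb hguess hn]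
    gcongr
    exact hK _

/-! ### Tapes seen from their heads -/

/-- What a machine does to one tape in one step: write a symbol, then move the head. -/
abbrev TapeOp : Type := Option Bool × SignType

/-- The effect of an operation on a tape whose cells are numbered relative to the head: the head
stays at cell `0` and the contents move. -/
def shiftTape (op : TapeOp) (T : TapeContent) : TapeContent :=
  fun i => Function.update T 0 op.1 (i + (op.2 : ℤ))

/-- The tape with the symbol `s` in the cells `a, …, b - 1`, blank elsewhere. -/
def block (s : Bool) (a b : ℤ) : TapeContent := fun i => if a ≤ i ∧ i < b then some s else none

section Block

variable {s : Bool} {a b a' b' i : ℤ} {m : SignType}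

theorem shiftTape_idle {T : TapeContent} {o : Option Bool} (h : T 0 = o) :
    shiftTape (o, 0) T = T := by
  subst h
  funext i
  simp [shiftTape]

theorem shiftTape_blank (m : SignType) : shiftTape (none, m) (fun _ => none) = fun _ => none := by
  funext i
  simp [shiftTape, Function.update_apply]

theorem block_of_mem (ha : a ≤ i) (hb : i < b) : block s a b i = some s :=
  if_pos ⟨ha, hb⟩

theorem block_of_lt (h : i < a) : block s a b i = none :=
  if_neg fun hi => hi.1.not_gt h

theorem block_of_le (h : b ≤ i) : block s a b i = none :=
  if_neg fun hi => hi.2.not_ge h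

theorem block_eq_blank (h : b ≤ a) : block s a b = fun _ => none :=
  funext fun _ => if_neg fun hi => (hi.1.trans_lt hi.2).not_ge h

theorem tapeOf_replicate (s : Bool) (n : ℕ) : tapeOf (List.replicate n s) = block s 0 n := by
  funext i
  by_cases h : 0 ≤ i
  · simp [tapeOf, block, h, List.getElem?_replicate, Int.toNat_lt h]
  · rw [tapeOf, if_neg h, block_of_lt (not_le.1 h)]

theorem shiftTape_block {o : Option Bool} (h : block s a b 0 = o) (ha : a - m = a')
    (hb : b - m = b') : shiftTape (o, m) (block s a b) = block s a' b' := by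
  subst h ha hb
  funext i
  rw [shiftTape, Function.update_eq_self, block, block]
  exact if_congr (by lia) rfl rfl

theorem shiftTape_block_push (h : a ≤ 0) (ha : a - m = a') (hb : 1 - m = b') :
    shiftTape (some s, m) (block s a 0) = block s a' b' := by
  subst ha hb
  funext i
  simp only [shiftTape, block, Function.update_apply]
  split_ifs <;> first | rfl | lia

theorem shiftTape_block_pop (ha : a - m = a') (hb : -m = b') :
    shiftTape (none, m) (block s a 1) = block s a' b' := by
  subst ha hb
  funext i
  simp only [shiftTape, block, Function.update_apply]
  split_ifs <;> first | rfl | lia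

end Block

/-! ### Clocks -/

/-- A Turing machine without input, with one tape for each element of `ι`, that runs for ever and
ticks in certain configurations. -/
structure Clock (ι : Type) where
  Q : Type
  finite_states : Finite Q
  start : Q
  δ : Q → (ι → Option Bool) → Q × (ι → TapeOp)
  tick : Q → (ι → Option Bool) → Bool

namespace Clock

variable {ι κ : Type}

/-- A configuration of a clock: the state, and the tapes as seen from their heads. -/
abbrev Conf (D : Clock ι) : Type := D.Q × (ι → TapeContent)

/-- One step of a clock. -/
def next (D : Clock ι) (c : D.Conf) : D.Conf :=
  ((D.δ c.1 fun x => c.2 x 0).1, fun x => shiftTape ((D.δ c.1 fun y => c.2 y 0).2 x) (c.2 x))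

/-- The clock ticks in the configuration `c`. -/
def TickAt (D : Clock ι) (c : D.Conf) : Prop := D.tick c.1 (fun x => c.2 x 0) = true

/-- The configuration at time `s`. All tapes are blank at time `0`. -/
def conf (D : Clock ι) (s : ℕ) : D.Conf := D.next^[s] (D.start, fun _ _ => none)

/-- The clock ticks at time `s`. -/
def Ticks (D : Clock ι) (s : ℕ) : Prop := D.TickAt (D.conf s)

instance (D : Clock ι) : DecidablePred D.Ticks := fun _ =>
  inferInstanceAs (Decidable (_ = true))

theorem conf_succ (D : Clock ι) (s : ℕ) : D.conf (s + 1) = D.next (D.conf s) :=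
  Function.iterate_succ_apply' _ _ _

theorem conf_add (D : Clock ι) (s n : ℕ) : D.conf (s + n) = D.next^[n] (D.conf s) := by
  rw [conf, add_comm, Function.iterate_add_apply, ← conf]

/-- In `n` steps, `D` gets from `c` to `c'`, and it does not tick before `c'`. -/
def Reach (D : Clock ι) (n : ℕ) (c c' : D.Conf) : Prop :=
  D.next^[n] c = c' ∧ ∀ m < n, ¬ D.TickAt (D.next^[m] c)

/-- From `c`, the clock makes `n` steps without a tick, then ticks and gets to `c'` in the next
step. -/
def Lap (D : Clock ι) (n : ℕ) (c c' : D.Conf) : Prop :=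
  ∃ c'', D.Reach n c c'' ∧ D.TickAt c'' ∧ D.next c'' = c'

section Reach

variable {D : Clock ι} {c c' c'' : D.Conf} {m n s : ℕ}

theorem Reach.refl (D : Clock ι) (c : D.Conf) : D.Reach 0 c c :=
  ⟨rfl, fun _ h => absurd h (Nat.not_lt_zero _)⟩

theorem Reach.of_next (h : D.next c = c') (hc : ¬ D.TickAt c) : D.Reach 1 c c' :=
  ⟨h, fun m hm => by rwa [Nat.lt_one_iff.1 hm]⟩

theorem Reach.trans (h : D.Reach m c c') (h' : D.Reach n c' c'') : D.Reach (m + n) c c'' := by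
  refine ⟨by rw [add_comm, Function.iterate_add_apply, h.1, h'.1], fun k hk => ?_⟩
  rcases lt_or_ge k m with hkm | hmk
  · exact h.2 k hkm
  · obtain ⟨l, rfl⟩ := Nat.exists_eq_add_of_le hmk
    rw [add_comm, Function.iterate_add_apply, h.1]
    exact h'.2 l (by lia)

theorem Reach.iterate {c : ℕ → D.Conf} (h : ∀ r < n, D.Reach m (c r) (c (r + 1))) :
    D.Reach (n * m) (c 0) (c n) := by
  induction n with
  | zero => rw [zero_mul]; exact .refl _ _
  | succ n ih =>
    rw [Nat.succ_mul]
    exact (ih fun r hr => h r (hr.trans n.lt_succ_self)).trans (h n n.lt_succ_self)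

theorem Reach.lap (h : D.Reach m c c') (h' : D.Lap n c' c'') : D.Lap (m + n) c c'' :=
  let ⟨e, hr, ht, hn⟩ := h'
  ⟨e, h.trans hr, ht, hn⟩

theorem Reach.conf_add (h : D.Reach n (D.conf s) c) : D.conf (s + n) = c := by
  rw [Clock.conf_add, h.1]

theorem Reach.count_add (h : D.Reach n (D.conf s) c) :
    Nat.count D.Ticks (s + n) = Nat.count D.Ticks s := by
  rw [Nat.count_add, Nat.add_eq_left, Nat.count_iff_forall_not]
  intro m hm
  rw [Ticks, Clock.conf_add]
  exact h.2 m hm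

theorem Lap.ticks_add (h : D.Lap n (D.conf s) c) : D.Ticks (s + n) := by
  obtain ⟨c', hr, ht, -⟩ := h
  rwa [Ticks, hr.conf_add]

theorem Lap.conf_add_succ (h : D.Lap n (D.conf s) c) : D.conf (s + n + 1) = c := by
  obtain ⟨c', hr, -, hn⟩ := h
  rw [conf_succ, hr.conf_add, hn]

theorem Lap.count_add_succ (h : D.Lap n (D.conf s) c) :
    Nat.count D.Ticks (s + n + 1) = Nat.count D.Ticks s + 1 := by
  rw [Nat.count_succ, if_pos h.ticks_add]
  obtain ⟨c', hr, -⟩ := h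
  rw [hr.count_add]

theorem Lap.add_le {s' : ℕ} (h : D.Lap n (D.conf s) c) (ht : D.Ticks s')
    (hs : Nat.count D.Ticks s' = Nat.count D.Ticks s) : s + n ≤ s' := by
  obtain ⟨c', hr, -⟩ := h
  by_contra! hlt
  have := Nat.count_strict_mono ht hlt
  rw [hr.count_add] at this
  lia

end Reach

section Laps

variable {D : Clock ι} {c : ℕ → D.Conf} {n : ℕ → ℕ}

theorem exists_conf_eq_count_eq (h0 : c 0 = D.conf 0) (h : ∀ j, D.Lap (n j) (c j) (c (j + 1)))
    (j : ℕ) : ∃ s, D.conf s = c j ∧ Nat.count D.Ticks s = j := by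
  induction j with
  | zero => exact ⟨0, h0.symm, Nat.count_zero _⟩
  | succ j ih =>
    obtain ⟨s, hs, hcount⟩ := ih
    have hlap := h j
    rw [← hs] at hlap
    exact ⟨_, hlap.conf_add_succ, by rw [hlap.count_add_succ, hcount]⟩

theorem infinite_ticks_of_laps (h0 : c 0 = D.conf 0)
    (h : ∀ j, D.Lap (n j) (c j) (c (j + 1))) : {s | D.Ticks s}.Infinite := by
  refine Set.infinite_of_forall_exists_gt fun N => ?_
  obtain ⟨s, hs, hcount⟩ := exists_conf_eq_count_eq h0 h (N + 1)
  have hlap := h (N + 1)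
  rw [← hs] at hlap
  have hle : Nat.count D.Ticks s ≤ s := Nat.count_le _
  exact ⟨_, hlap.ticks_add, by lia⟩

theorem le_of_laps (h0 : c 0 = D.conf 0) (h : ∀ j, D.Lap (n j) (c j) (c (j + 1))) {s : ℕ}
    (hs : D.Ticks s) : n (Nat.count D.Ticks s) ≤ s := by
  obtain ⟨r, hr, hcount⟩ := exists_conf_eq_count_eq h0 h (Nat.count D.Ticks s)
  have hlap := h (Nat.count D.Ticks s)
  rw [← hr] at hlap
  exact le_of_add_le_right (hlap.add_le hs hcount.symm)

end Laps

/-- The clock that runs `G` and makes a step of `E` whenever `G` ticks. It ticks when both do. -/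
def drive (G : Clock ι) (E : Clock κ) : Clock (ι ⊕ κ) where
  Q := G.Q × E.Q
  finite_states := by
    have := G.finite_states
    have := E.finite_states
    infer_instance
  start := (G.start, E.start)
  δ q r :=
    let g := G.δ q.1 fun x => r (.inl x)
    let e := E.δ q.2 fun x => r (.inr x)
    if G.tick q.1 fun x => r (.inl x) then ((g.1, e.1), Sum.elim g.2 e.2)
    else ((g.1, q.2), Sum.elim g.2 fun x => (r (.inr x), 0))
  tick q r := (G.tick q.1 fun x => r (.inl x)) && E.tick q.2 fun x => r (.inr x)

section Drive

variable {G : Clock ι} {E : Clock κ}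

/-- The configuration of `G.drive E` composed of configurations of `G` and of `E`. -/
def driveConf (g : G.Conf) (e : E.Conf) : (G.drive E).Conf :=
  ((g.1, e.1), Sum.elim g.2 e.2)

theorem next_driveConf_of_tickAt {g : G.Conf} (h : G.TickAt g) (e : E.Conf) :
    (G.drive E).next (driveConf g e) = driveConf (G.next g) (E.next e) := by
  rw [TickAt] at h
  simp only [next, drive, driveConf, Sum.elim_inl, Sum.elim_inr, h, if_true]
  refine Prod.ext rfl (funext fun x => ?_)
  cases x <;> rfl

theorem next_driveConf_of_not_tickAt {g : G.Conf} (h : ¬ G.TickAt g) (e : E.Conf) :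
    (G.drive E).next (driveConf g e) = driveConf (G.next g) e := by
  rw [TickAt] at h
  simp only [next, drive, driveConf, Sum.elim_inl, Sum.elim_inr, h]
  refine Prod.ext rfl (funext fun x => ?_)
  cases x
  · rfl
  · exact shiftTape_idle rfl

theorem conf_drive (G : Clock ι) (E : Clock κ) (s : ℕ) :
    (G.drive E).conf s = driveConf (G.conf s) (E.conf (Nat.count G.Ticks s)) := by
  induction s with
  | zero =>
    refine Prod.ext rfl (funext fun x => ?_)
    cases x <;> rfl
  | succ s ih =>
    rw [conf_succ, ih, conf_succ, Nat.count_succ]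
    split_ifs with h
    · rw [conf_succ, next_driveConf_of_tickAt h]
    · rw [add_zero, next_driveConf_of_not_tickAt h]

theorem ticks_drive {s : ℕ} :
    (G.drive E).Ticks s ↔ G.Ticks s ∧ E.Ticks (Nat.count G.Ticks s) := by
  rw [Ticks, TickAt, conf_drive]
  exact Bool.and_eq_true_iff

theorem count_ticks_drive (G : Clock ι) (E : Clock κ) (s : ℕ) :
    Nat.count (G.drive E).Ticks s = Nat.count E.Ticks (Nat.count G.Ticks s) := by
  induction s with
  | zero => simp
  | succ s ih =>
    rw [Nat.count_succ, Nat.count_succ, ih]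
    by_cases h : G.Ticks s
    · simp [ticks_drive, h, Nat.count_succ]
    · simp [ticks_drive, h]

theorem infinite_ticks_drive (hG : {s | G.Ticks s}.Infinite) (hE : {s | E.Ticks s}.Infinite) :
    {s | (G.drive E).Ticks s}.Infinite := by
  refine Set.infinite_of_forall_exists_gt fun N => ?_
  obtain ⟨e, he, hN⟩ := hE.exists_gt N
  refine ⟨Nat.nth G.Ticks e, ticks_drive.2 ⟨Nat.nth_mem_of_infinite hG e, ?_⟩,
    hN.trans_le (Nat.nth_strictMono hG).le_apply⟩
  rwa [Nat.count_nth_of_infinite hG]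

end Drive

/-! ### A clock with exponentially growing pauses -/

/-- A clock with two tapes, which hold numbers in unary. One number is taken down to `0` while `2`
is added to the other one at every step; then the clock ticks, adds `1` and exchanges the roles of
the tapes. In the state `(p, q)`, the tape `p` is the decreasing one, and `q` is set while the
second of the two ones is due. -/
def doubling : Clock Bool where
  Q := Bool × Bool
  finite_states := inferInstance
  start := (false, false)
  δ q r :=
    if q.2 then ((q.1, false), fun x => if x = q.1 then (r x, 0) else (some true, 1))
    else if (r q.1).isSome then
      ((q.1, true), fun x => if x = q.1 then (none, -1) else (some true, 1))
    else ((!q.1, false), fun x => if x = q.1 then (r x, 0) else (some true, 0))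
  tick q r := !q.2 && !(r q.1).isSome

/-- The configuration of the doubling clock in the state `(p, q)` with the number `u` on the tape
`p` and the number `v` on the other one. The head of the tape `p` is on the last one, that of the
other tape behind the last one. -/
def doublingConf (p q : Bool) (u v : ℕ) : doubling.Conf :=
  ((p, q), fun x => if x = p then block true (1 - u) 1 else block true (-v) 0)

theorem next_doublingConf_true (p : Bool) (u v : ℕ) :
    doubling.next (doublingConf p true u v) = doublingConf p false u (v + 1) := by
  refine Prod.ext rfl (funext fun x => ?_)
  simp only [next, doublingConf, doubling, if_true]
  by_cases h : x = p
  · simp only [h, if_true]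
    exact shiftTape_idle rfl
  · simp only [h, if_false]
    exact shiftTape_block_push (by lia) (by simp; lia) (by simp)

theorem next_doublingConf_false_succ (p : Bool) (u v : ℕ) :
    doubling.next (doublingConf p false (u + 1) v) = doublingConf p true u (v + 1) := by
  have hp : block true (1 - (u + 1 : ℕ)) 1 0 = some true := block_of_mem (by lia) one_pos
  simp only [next, doublingConf, doubling, hp, Option.isSome_some, if_true, Bool.false_eq_true,
    if_false]
  refine Prod.ext rfl (funext fun x => ?_)
  by_cases h : x = p
  · simp only [h, if_true]
    exact shiftTape_block_pop (by simp; lia) (by simp)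
  · simp only [h, if_false]
    exact shiftTape_block_push (by lia) (by simp; lia) (by simp)

theorem next_doublingConf_false_zero (p : Bool) (v : ℕ) :
    doubling.next (doublingConf p false 0 v) = doublingConf (!p) false (v + 1) 0 := by
  have hp : block true (1 - (0 : ℕ)) 1 0 = none := block_of_lt (by simp)
  simp only [next, doublingConf, doubling, hp, Option.isSome_none, if_true, Bool.false_eq_true,
    if_false]
  refine Prod.ext rfl (funext fun x => ?_)
  by_cases h : x = p
  · simp only [h, if_true, Bool.eq_not_self, if_false, hp]
    rw [block_eq_blank (by simp), block_eq_blank (by simp), shiftTape_blank]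
  · simp only [if_neg h, if_pos (Bool.eq_not_of_ne h)]
    exact shiftTape_block_push (a := -v) (by lia) (by simp) (by simp)

theorem tickAt_doublingConf {p q : Bool} {u v : ℕ} :
    doubling.TickAt (doublingConf p q u v) ↔ q = false ∧ u = 0 := by
  cases u <;> simp [TickAt, doublingConf, doubling, block]

theorem lap_doubling (p : Bool) (u : ℕ) :
    doubling.Lap (u * 2) (doublingConf p false u 0) (doublingConf (!p) false (2 * u + 1) 0) := by
  refine ⟨doublingConf p false 0 (2 * u), ?_, tickAt_doublingConf.2 ⟨rfl, rfl⟩,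
    next_doublingConf_false_zero p _⟩
  have hround : ∀ r < u, doubling.Reach 2 (doublingConf p false (u - r) (2 * r))
      (doublingConf p false (u - (r + 1)) (2 * (r + 1))) := fun r hr => by
    obtain ⟨l, hl⟩ := Nat.exists_eq_add_of_lt hr
    rw [show u - r = l + 1 by lia, show u - (r + 1) = l by lia]
    exact (Reach.of_next (next_doublingConf_false_succ p l (2 * r))
      (by simp [tickAt_doublingConf])).trans
        (Reach.of_next (next_doublingConf_true p l (2 * r + 1)) (by simp [tickAt_doublingConf]))
  simpa only [Nat.sub_zero, mul_zero, Nat.sub_self] using Reach.iterate hround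

theorem doublingConf_start : doublingConf false false 0 0 = doubling.conf 0 := by
  refine Prod.ext rfl (funext fun x => ?_)
  simp only [doublingConf]
  split_ifs <;> exact block_eq_blank (by simp)

theorem lap_doubling_pow (j : ℕ) :
    doubling.Lap ((2 ^ j - 1) * 2) (doublingConf j.bodd false (2 ^ j - 1) 0)
      (doublingConf (j + 1).bodd false (2 ^ (j + 1) - 1) 0) := by
  have h := lap_doubling j.bodd (2 ^ j - 1)
  have hj : 0 < 2 ^ j := by positivity
  rwa [← Nat.bodd_succ, show 2 * (2 ^ j - 1) + 1 = 2 ^ (j + 1) - 1 by rw [pow_succ]; lia] at h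

theorem infinite_ticks_doubling : {s | doubling.Ticks s}.Infinite :=
  infinite_ticks_of_laps (c := fun j => doublingConf j.bodd false (2 ^ j - 1) 0)
    doublingConf_start lap_doubling_pow

theorem two_pow_count_ticks_doubling_le {s : ℕ} (h : doubling.Ticks s) :
    2 ^ Nat.count doubling.Ticks s ≤ s + 1 := by
  have := le_of_laps (c := fun j => doublingConf j.bodd false (2 ^ j - 1) 0)
    doublingConf_start lap_doubling_pow h
  lia

/-- The clock `E` with doubly exponentially growing pauses between its steps. -/
def slow (E : Clock κ) : Clock (Bool ⊕ Bool ⊕ κ) := doubling.drive (doubling.drive E)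

section Slow

variable {E : Clock κ}

theorem infinite_ticks_slow (hE : {s | E.Ticks s}.Infinite) : {s | E.slow.Ticks s}.Infinite :=
  infinite_ticks_drive infinite_ticks_doubling (infinite_ticks_drive infinite_ticks_doubling hE)

theorem exists_ticks_of_ticks_slow {s : ℕ} (h : E.slow.Ticks s) :
    ∃ e, E.Ticks e ∧ Nat.count E.Ticks e = Nat.count E.slow.Ticks s ∧
      2 ^ (2 ^ e - 1) ≤ s + 1 := by
  obtain ⟨hs, h'⟩ := ticks_drive.1 h
  obtain ⟨hr, he⟩ := ticks_drive.1 h'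
  refine ⟨_, he, by rw [slow, count_ticks_drive, count_ticks_drive], ?_⟩
  calc 2 ^ (2 ^ _ - 1) ≤ 2 ^ Nat.count doubling.Ticks s :=
        Nat.pow_le_pow_right two_pos
          (Nat.sub_le_iff_le_add.2 (two_pow_count_ticks_doubling_le hr))
    _ ≤ s + 1 := two_pow_count_ticks_doubling_le hs

theorem two_pow_two_pow_nth_le (hE : {s | E.Ticks s}.Infinite) (k : ℕ) :
    2 ^ (2 ^ Nat.nth E.Ticks k - 1) ≤ Nat.nth E.slow.Ticks k + 1 := by
  have hslow := infinite_ticks_slow hE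
  obtain ⟨e, he, hcount, hle⟩ :=
    exists_ticks_of_ticks_slow (Nat.nth_mem_of_infinite (p := E.slow.Ticks) hslow k)
  rw [Nat.count_nth_of_infinite hslow] at hcount
  subst hcount
  rwa [Nat.nth_count he]

end Slow

end Clock

/-! ### Configurations of machines seen from their heads -/

/-- The tapes of a configuration as seen from their heads. -/
def Config.view {M : Machine} (c : Config M) : TapeName M.k → TapeContent :=
  fun x i => c.tape x (c.head x + i)

/-- The tape is blank outside the cells `lo, …, hi`. -/
def SupportedIn (lo hi : ℤ) (T : TapeContent) : Prop := ∀ i, T i ≠ none → lo ≤ i ∧ i ≤ hi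

namespace SupportedIn

variable {lo hi lo' hi' : ℤ} {T : TapeContent}

theorem mono (h : SupportedIn lo hi T) (hlo : lo' ≤ lo) (hhi : hi ≤ hi') :
    SupportedIn lo' hi' T :=
  fun i hi => ⟨hlo.trans (h i hi).1, (h i hi).2.trans hhi⟩

theorem shift (h : SupportedIn lo hi T) (hlo : lo ≤ 0) (hhi : 0 ≤ hi) (op : TapeOp) :
    SupportedIn (lo - 1) (hi + 1) (shiftTape op T) := by
  intro i hi
  have hop : ((op.2 : ℤ) = -1 ∨ (op.2 : ℤ) = 0 ∨ (op.2 : ℤ) = 1) := by cases op.2 <;> simp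
  rw [shiftTape] at hi
  by_cases h0 : i + (op.2 : ℤ) = 0
  · lia
  · rw [Function.update_of_ne h0] at hi
    have := h _ hi
    lia

theorem erase (h : SupportedIn lo hi T) (m : SignType) :
    SupportedIn (lo - m) (hi - m) (shiftTape (none, m) T) := by
  intro i hi
  by_cases h0 : i + (m : ℤ) = 0
  · simp [shiftTape, h0] at hi
  · rw [shiftTape, Function.update_of_ne h0] at hi
    have := h _ hi
    lia

theorem erase_right (h : SupportedIn 0 hi T) : SupportedIn 0 (hi - 1) (shiftTape (none, 1) T) := by
  intro i hi
  by_cases h0 : i + 1 = 0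
  · simp [shiftTape, h0] at hi
  · rw [shiftTape, SignType.coe_one, Function.update_of_ne h0] at hi
    have := h _ hi
    lia

theorem iterate_erase_left (h : SupportedIn lo hi T) (n : ℕ) :
    SupportedIn (lo + n) (hi + n) ((shiftTape (none, -1))^[n] T) := by
  induction n with
  | zero => simpa using h
  | succ n ih =>
    rw [Function.iterate_succ_apply']
    convert ih.erase (-1) using 1 <;> simp <;> ring

theorem iterate_erase_right (h : SupportedIn 0 hi T) (n : ℕ) :
    SupportedIn 0 (hi - n) ((shiftTape (none, 1))^[n] T) := by
  induction n with
  | zero => simpa using h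
  | succ n ih =>
    rw [Function.iterate_succ_apply', Nat.cast_succ, ← sub_sub]
    exact ih.erase_right

theorem erase_eq_blank (h : SupportedIn 0 0 T) : shiftTape (none, 0) T = fun _ => none := by
  funext i
  by_contra hi
  have := h.erase 0 i hi
  obtain rfl : i = 0 := by simpa using le_antisymm this.2 this.1
  simp [shiftTape] at hi

theorem erase_sweeps_eq_blank {c : ℕ} (h : SupportedIn (-c) c T) :
    shiftTape (none, 0) ((shiftTape (none, 1))^[c] (shiftTape (none, 0)
      ((shiftTape (none, 1))^[c] (shiftTape (none, 0) ((shiftTape (none, -1))^[c]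
        (shiftTape (none, 0) T)))))) = fun _ => none := by
  have hleft : SupportedIn 0 (2 * c) ((shiftTape (none, -1))^[c] (shiftTape (none, 0) T)) :=
    ((h.erase 0).iterate_erase_left c).mono (by simp) (by simp; lia)
  have hright := ((hleft.erase 0).mono (le_of_eq (by simp)) le_rfl).iterate_erase_right c
  have hback := ((hright.erase 0).mono (le_of_eq (by simp)) le_rfl).iterate_erase_right c
  exact (hback.mono le_rfl (by simp; lia)).erase_eq_blank

end SupportedIn

namespace Machine

variable {M : Machine} {Z : BinSeq}

theorem action_eq_view (M : Machine) (c : Config M) :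
    M.action c = M.δ c.state fun x => c.view x 0 := by
  simp [action, Config.view]

theorem view_step {c : Config M} {next : M.Q} {op : TapeName M.k → TapeOp}
    (h : M.action c = .act next op) : (M.step Z c).view = fun x => shiftTape (op x) (c.view x) := by
  rw [step_of_act h]
  funext x i
  simp only [Config.view, shiftTape, Function.update_apply]
  rw [show c.head x + ((op x).2 : ℤ) + i = c.head x + (i + ((op x).2 : ℤ)) by ring]
  exact if_congr add_eq_left rfl rfl

theorem view_init (M : Machine) (w : List Bool) (x : TapeName M.k) :
    (M.init w).view x = (M.init w).tape x :=
  funext fun i => congrArg _ (zero_add i)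

theorem supportedIn_tapeOf (w : List Bool) : SupportedIn (-w.length) w.length (tapeOf w) := by
  intro i hi
  by_cases h : 0 ≤ i
  · have : i.toNat < w.length := by simpa [tapeOf, h] using hi
    lia
  · simp [tapeOf, h] at hi

theorem supportedIn_view_run (M : Machine) (Z : BinSeq) (w : List Bool) (T : ℕ) (x : TapeName M.k) :
    SupportedIn (-(w.length + T : ℕ)) (w.length + T : ℕ) ((M.run Z w T).view x) := by
  induction T with
  | zero =>
    rw [run, Function.iterate_zero_apply, view_init]
    cases x
    case input => exact supportedIn_tapeOf w
    all_goals exact fun i hi => absurd rfl hi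
  | succ T ih =>
    rw [run_succ]
    cases ha : M.action (M.run Z w T) with
    | halt => rw [step_of_halted ha]; exact ih.mono (by lia) (by lia)
    | ask next => rw [step_of_ask ha]; exact ih.mono (by lia) (by lia)
    | act next op =>
      rw [view_step ha]
      exact (ih.shift (by lia) (by lia) (op x)).mono (by lia) (by lia)

end Machine

/-! ### Running a machine on all unary inputs -/

/-- The tapes of the clock `unaryRuns M`: the current input in unary, the number of steps of the
current run in unary, and the tapes of `M`. -/
inductive RunTape (k : ℕ) : Type
  | arg
  | fuel
  | inner (x : TapeName k)

instance (k : ℕ) : Finite (RunTape k) :=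
  Finite.of_surjective (Sum.elim ![.arg, .fuel] .inner : Fin 2 ⊕ TapeName k → _)
    fun
    | .arg => ⟨.inl 0, rfl⟩
    | .fuel => ⟨.inl 1, rfl⟩
    | .inner x => ⟨.inr x, rfl⟩

/-- The states of the clock `unaryRuns M`: it copies the input while moving to the right, takes the
heads back, simulates `M`, and clears the tapes of `M` in three sweeps. -/
inductive RunState (Q : Type) : Type
  | copy
  | back
  | sim (q : Q)
  | sweepLeft
  | sweepRight
  | sweepBack

instance (Q : Type) [Finite Q] : Finite (RunState Q) :=
  Finite.of_surjective
    (Sum.elim ![.copy, .back, .sweepLeft, .sweepRight, .sweepBack] .sim : Fin 5 ⊕ Q → _)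
    fun
    | .copy => ⟨.inl 0, rfl⟩
    | .back => ⟨.inl 1, rfl⟩
    | .sweepLeft => ⟨.inl 2, rfl⟩
    | .sweepRight => ⟨.inl 3, rfl⟩
    | .sweepBack => ⟨.inl 4, rfl⟩
    | .sim q => ⟨.inr q, rfl⟩

section Families

variable {k : ℕ} {α : Type}

/-- The family with the value `a` at `arg`, `f` at `fuel` and `v x` at `inner x`. -/
def onRunTapes (a f : α) (v : TapeName k → α) : RunTape k → α
  | .arg => a
  | .fuel => f
  | .inner x => v x

/-- The family with the value `a` at the input tape and `b` at all other tapes. -/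
def onInput (a b : α) : TapeName k → α
  | .input => a
  | _ => b

theorem shiftTape_onInput {o : TapeOp} {T T' : TapeContent} (h : shiftTape o T = T') :
    (fun x : TapeName k => shiftTape (onInput o (none, 0) x) (onInput T (fun _ => none) x)) =
      onInput T' fun _ => none := by
  funext x
  cases x
  case input => exact h
  all_goals exact shiftTape_blank 0

theorem onInput_self (a : α) : (onInput a a : TapeName k → α) = fun _ => a := by
  funext x
  cases x <;> rfl

end Families

/-- The clock that runs `M` on `1ʲ` for `j = 0, 1, …` and ticks after each of these runs. The number
of steps kept on the tape `fuel` bounds the distance of all nonblank cells from the heads, so that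
sweeps of this length clear the tapes of `M`. -/
def unaryRuns (M : Machine) : Clock (RunTape M.k) where
  Q := RunState M.Q
  finite_states := by
    have := M.finite_states
    infer_instance
  start := .copy
  δ
    | .copy, r =>
      if (r .arg).isSome then
        (.copy, onRunTapes (some true, 1) (some true, 1) (onInput (some true, 1) (none, 0)))
      else (.back, onRunTapes (some true, -1) (some true, 1) (onInput (none, -1) (none, 0)))
    | .back, r =>
      if (r .arg).isSome then
        (.back, onRunTapes (some true, -1) (some true, 1) (onInput (some true, -1) (none, 0)))
      else (.sim M.start, onRunTapes (none, 1) (some true, 1) (onInput (none, 1) (none, 0)))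
    | .sim q, r =>
      match M.δ q fun x => r (.inner x) with
      | .act next op => (.sim next, onRunTapes (r .arg, 0) (some true, 1) op)
      | _ => (.sweepLeft, onRunTapes (r .arg, 0) (none, -1) fun _ => (none, 0))
    | .sweepLeft, r =>
      if (r .fuel).isSome then
        (.sweepLeft, onRunTapes (r .arg, 0) (some true, -1) fun _ => (none, -1))
      else (.sweepRight, onRunTapes (r .arg, 0) (none, 1) fun _ => (none, 0))
    | .sweepRight, r =>
      if (r .fuel).isSome then
        (.sweepRight, onRunTapes (r .arg, 0) (some true, 1) fun _ => (none, 1))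
      else (.sweepBack, onRunTapes (r .arg, 0) (none, -1) fun _ => (none, 0))
    | .sweepBack, r =>
      if (r .fuel).isSome then
        (.sweepBack, onRunTapes (r .arg, 0) (none, -1) fun _ => (none, 1))
      else (.copy, onRunTapes (r .arg, 0) (none, 0) fun _ => (none, 0))
  tick
    | .sweepBack, r => (r .fuel).isNone
    | _, _ => false

section UnaryRuns

variable {M : Machine} {q q' : RunState M.Q} {A A' F F' : TapeContent}
  {V V' : TapeName M.k → TapeContent} {a f : TapeOp} {v : TapeName M.k → TapeOp}

/-- The configuration of `unaryRuns M` with the state `q`, the tape `A` that carries the input, the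
tape `F` that counts the steps, and the tapes `V` of `M`. -/
def runConf (q : RunState M.Q) (A F : TapeContent) (V : TapeName M.k → TapeContent) :
    (unaryRuns M).Conf :=
  (q, onRunTapes A F V)

theorem next_runConf
    (h : (unaryRuns M).δ q (onRunTapes (A 0) (F 0) fun x => V x 0) = (q', onRunTapes a f v)) :
    (unaryRuns M).next (runConf q A F V) =
      runConf q' (shiftTape a A) (shiftTape f F) fun x => shiftTape (v x) (V x) := by
  have hread : (fun x => onRunTapes A F V x 0) = onRunTapes (A 0) (F 0) fun x => V x 0 := by
    funext x
    cases x <;> rfl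
  simp only [Clock.next, runConf, hread, h]
  refine Prod.ext rfl (funext fun x => ?_)
  cases x <;> rfl

theorem tickAt_runConf : (unaryRuns M).TickAt (runConf q A F V) ↔ q = .sweepBack ∧ F 0 = none := by
  cases q <;> simp [Clock.TickAt, runConf, unaryRuns, onRunTapes]

theorem reach_runConf
    (h : (unaryRuns M).δ q (onRunTapes (A 0) (F 0) fun x => V x 0) = (q', onRunTapes a f v))
    (hq : q = .sweepBack → F 0 ≠ none) (hA : shiftTape a A = A') (hF : shiftTape f F = F')
    (hV : (fun x => shiftTape (v x) (V x)) = V') :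
    (unaryRuns M).Reach 1 (runConf q A F V) (runConf q' A' F' V') := by
  subst hA hF hV
  exact .of_next (next_runConf h) fun ht =>
    hq (tickAt_runConf.1 ht).1 (tickAt_runConf.1 ht).2

theorem reach_copy (M : Machine) (j : ℕ) :
    (unaryRuns M).Reach j (runConf .copy (block true 0 j) (fun _ => none) fun _ _ => none)
      (runConf .copy (block true (-j) 0) (block true (-j) 0)
        (onInput (block true (-j) 0) fun _ => none)) := by
  have hstep : ∀ r < j, (unaryRuns M).Reach 1
      (runConf .copy (block true (-r) (j - r)) (block true (-r) 0)
        (onInput (block true (-r) 0) fun _ => none))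
      (runConf .copy (block true (-(r + 1 : ℕ)) (j - (r + 1 : ℕ))) (block true (-(r + 1 : ℕ)) 0)
        (onInput (block true (-(r + 1 : ℕ)) 0) fun _ => none)) := fun r hr => by
    have h0 : block true (-r) (j - r) 0 = some true := block_of_mem (by lia) (by lia)
    have hpush : shiftTape (some true, 1) (block true (-r) 0) = block true (-(r + 1 : ℕ)) 0 :=
      shiftTape_block_push (by lia) (by simp; lia) (by simp)
    exact reach_runConf (a := (some true, 1)) (by simp [unaryRuns, onRunTapes, h0]) (by simp)
      (shiftTape_block h0 (by simp; lia) (by simp; lia)) hpush (shiftTape_onInput hpush)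
  simpa [block_eq_blank, onInput_self] using Clock.Reach.iterate hstep

theorem reach_back (M : Machine) (j : ℕ) :
    (unaryRuns M).Reach j
      (runConf .back (block true (1 - j) 2) (block true (-(j + 1 : ℕ)) 0)
        (onInput (block true (1 - j) 1) fun _ => none))
      (runConf .back (block true 1 (j + 2)) (block true (-(2 * j + 1 : ℕ)) 0)
        (onInput (block true 1 (j + 1)) fun _ => none)) := by
  have hstep : ∀ r < j, (unaryRuns M).Reach 1
      (runConf .back (block true (1 - j + r) (r + 2)) (block true (-(j + r + 1 : ℕ)) 0)
        (onInput (block true (1 - j + r) (r + 1)) fun _ => none))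
      (runConf .back (block true (1 - j + (r + 1 : ℕ)) ((r + 1 : ℕ) + 2))
        (block true (-(j + (r + 1) + 1 : ℕ)) 0)
        (onInput (block true (1 - j + (r + 1 : ℕ)) ((r + 1 : ℕ) + 1)) fun _ => none)) :=
    fun r hr => by
    have h0 : block true (1 - j + r) (r + 2) 0 = some true := block_of_mem (by lia) (by lia)
    have h1 : block true (1 - j + r) (r + 1) 0 = some true := block_of_mem (by lia) (by lia)
    exact reach_runConf (a := (some true, -1)) (f := (some true, 1))
      (v := onInput (some true, -1) (none, 0)) (by simp [unaryRuns, onRunTapes, h0]) (by simp)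
      (shiftTape_block h0 (by simp; lia) (by simp; lia))
      (shiftTape_block_push (by lia) (by simp; lia) (by simp))
      (shiftTape_onInput (shiftTape_block h1 (by simp; lia) (by simp)))
  simpa [two_mul] using Clock.Reach.iterate hstep

theorem reach_sim_start (M : Machine) (j : ℕ) :
    (unaryRuns M).Reach (2 * j + 2)
      (runConf .copy (block true 0 j) (fun _ => none) fun _ _ => none)
      (runConf (.sim M.start) (block true 0 (j + 1)) (block true (-(2 * j + 2 : ℕ)) 0)
        (M.init (List.replicate j true)).view) := by
  have hturn : (unaryRuns M).Reach 1
      (runConf .copy (block true (-j) 0) (block true (-j) 0)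
        (onInput (block true (-j) 0) fun _ => none))
      (runConf .back (block true (1 - j) 2) (block true (-(j + 1 : ℕ)) 0)
        (onInput (block true (1 - j) 1) fun _ => none)) := by
    have h0 : block true (-j) 0 0 = none := block_of_le le_rfl
    exact reach_runConf (a := (some true, -1)) (f := (some true, 1))
      (v := onInput (none, -1) (none, 0)) (by simp [unaryRuns, onRunTapes, h0]) (by simp)
      (shiftTape_block_push (by lia) (by simp; lia) (by simp))
      (shiftTape_block_push (by lia) (by simp; lia) (by simp))
      (shiftTape_onInput (shiftTape_block h0 (by simp; lia) (by simp)))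
  have hstart : (unaryRuns M).Reach 1
      (runConf .back (block true 1 (j + 2)) (block true (-(2 * j + 1 : ℕ)) 0)
        (onInput (block true 1 (j + 1)) fun _ => none))
      (runConf (.sim M.start) (block true 0 (j + 1)) (block true (-(2 * j + 2 : ℕ)) 0)
        (M.init (List.replicate j true)).view) := by
    have h0 : ∀ b, block true 1 b 0 = none := fun b => block_of_lt one_pos
    have hview : (M.init (List.replicate j true)).view =
        onInput (block true 0 j) fun _ => none := by
      funext x
      rw [Machine.view_init]
      cases x
      case input => exact tapeOf_replicate true j
      all_goals rfl
    rw [hview]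
    exact reach_runConf (a := (none, 1)) (f := (some true, 1)) (v := onInput (none, 1) (none, 0))
      (by simp [unaryRuns, onRunTapes, h0]) (by simp)
      (shiftTape_block (h0 _) (by simp) (by simp; lia))
      (shiftTape_block_push (by lia) (by simp; lia) (by simp))
      (shiftTape_onInput (shiftTape_block (h0 _) (by simp) (by simp)))
  convert ((reach_copy M j).trans hturn).trans ((reach_back M j).trans hstart) using 1
  ring

theorem reach_sim (hM : M.OracleFree) {Z : BinSeq} {w : List Bool} {m n : ℕ}
    (hn : ∀ r < n, ¬ M.Halted (M.run Z w r)) :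
    (unaryRuns M).Reach n (runConf (.sim M.start) A (block true (-m) 0) (M.init w).view)
      (runConf (.sim (M.run Z w n).state) A (block true (-(m + n : ℕ)) 0) (M.run Z w n).view) := by
  let c := fun r => runConf (.sim (M.run Z w r).state) A (block true (-(m + r : ℕ)) 0)
    (M.run Z w r).view
  have hstep : ∀ r < n, (unaryRuns M).Reach 1 (c r) (c (r + 1)) := fun r hr => by
    dsimp only [c]
    cases ha : M.action (M.run Z w r) with
    | halt => exact absurd ha (hn r hr)
    | ask next => exact absurd ha (hM _ _ next)
    | act next op =>
      have hδ := (M.action_eq_view _).symm.trans ha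
      rw [Machine.run_succ, Machine.view_step ha, Machine.step_of_act ha]
      exact reach_runConf (a := (A 0, 0)) (f := (some true, 1)) (v := op)
        (by simp [unaryRuns, onRunTapes, hδ]) (by simp) (shiftTape_idle rfl)
        (shiftTape_block_push (by lia) (by simp; lia) (by simp)) rfl
  have h := Clock.Reach.iterate hstep
  rw [mul_one] at h
  exact h

theorem reach_sweep {F : ℕ → TapeContent} {m : SignType} {c : ℕ} (hq : ∀ v,
      (unaryRuns M).δ q (onRunTapes (A 0) (some true) v) =
        (q, onRunTapes (A 0, 0) f fun _ => (none, m)))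
    (h0 : ∀ r < c, F r 0 = some true) (hF : ∀ r < c, shiftTape f (F r) = F (r + 1)) :
    (unaryRuns M).Reach c (runConf q A (F 0) V)
      (runConf q A (F c) fun x => (shiftTape (none, m))^[c] (V x)) := by
  have hstep : ∀ r < c, (unaryRuns M).Reach 1
      (runConf q A (F r) fun x => (shiftTape (none, m))^[r] (V x))
      (runConf q A (F (r + 1)) fun x => (shiftTape (none, m))^[r + 1] (V x)) := fun r hr =>
    reach_runConf (by rw [h0 r hr]; exact hq _) (by simp [h0 r hr]) (shiftTape_idle rfl) (hF r hr)
      (by simp only [Function.iterate_succ_apply'])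
  simpa using Clock.Reach.iterate hstep

theorem reach_sweepLeft (c : ℕ) (A : TapeContent) (V : TapeName M.k → TapeContent) :
    (unaryRuns M).Reach (c + 1) (runConf .sweepLeft A (block true (1 - c) 1) V)
      (runConf .sweepRight A (block true 0 c)
        fun x => shiftTape (none, 0) ((shiftTape (none, -1))^[c] (V x))) := by
  have h0 : ∀ r < c, block true (1 - c + r) (1 + r) 0 = some true :=
    fun r hr => block_of_mem (by lia) (by lia)
  have hend : block true 1 (1 + c) 0 = none := block_of_lt one_pos
  have hsweep := reach_sweep (q := .sweepLeft) (A := A) (V := V) (f := (some true, -1)) (m := -1)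
    (F := fun r => block true (1 - c + r) (1 + r)) (fun v => by simp [unaryRuns, onRunTapes]) h0
    fun r hr => shiftTape_block (h0 r hr) (by simp; lia) (by simp; lia)
  rw [sub_add_cancel, Nat.cast_zero, add_zero, add_zero] at hsweep
  exact hsweep.trans <| reach_runConf (a := (A 0, 0)) (f := (none, 1))
    (by simp [unaryRuns, onRunTapes, hend]) (by simp) (shiftTape_idle rfl)
    (shiftTape_block hend (by simp) (by simp)) rfl

theorem reach_sweepRight (c : ℕ) (A : TapeContent) (V : TapeName M.k → TapeContent) :
    (unaryRuns M).Reach (c + 1) (runConf .sweepRight A (block true 0 c) V)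
      (runConf .sweepBack A (block true (1 - c) 1)
        fun x => shiftTape (none, 0) ((shiftTape (none, 1))^[c] (V x))) := by
  have h0 : ∀ r < c, block true (0 - r) (c - r) 0 = some true :=
    fun r hr => block_of_mem (by lia) (by lia)
  have hend : block true (0 - c) 0 0 = none := block_of_le le_rfl
  have hsweep := reach_sweep (q := .sweepRight) (A := A) (V := V) (f := (some true, 1)) (m := 1)
    (F := fun r => block true (0 - r) (c - r)) (fun v => by simp [unaryRuns, onRunTapes]) h0
    fun r hr => shiftTape_block (h0 r hr) (by simp; lia) (by simp; lia)
  rw [sub_self, Nat.cast_zero, sub_zero, sub_zero] at hsweep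
  exact hsweep.trans <| reach_runConf (a := (A 0, 0)) (f := (none, -1))
    (by rw [hend]; simp [unaryRuns, onRunTapes]) (by simp) (shiftTape_idle rfl)
    (shiftTape_block hend (by simp; lia) (by simp)) rfl

theorem reach_sweepBack (c : ℕ) (A : TapeContent) (V : TapeName M.k → TapeContent) :
    (unaryRuns M).Reach c (runConf .sweepBack A (block true (1 - c) 1) V)
      (runConf .sweepBack A (fun _ => none) fun x => (shiftTape (none, 1))^[c] (V x)) := by
  simpa [block_eq_blank] using reach_sweep (q := .sweepBack) (A := A) (V := V) (f := (none, -1))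
    (m := 1) (c := c) (F := fun r => block true (1 - c + r) 1)
    (fun v => by simp [unaryRuns, onRunTapes]) (fun r hr => block_of_mem (by lia) (by lia))
    fun r _ => shiftTape_block_pop (by simp; lia) (by simp)

theorem lap_clear {q : M.Q} {c : ℕ} (hq : M.δ q (fun x => V x 0) = .halt)
    (hV : ∀ x, SupportedIn (-c) c (V x)) :
    (unaryRuns M).Lap (3 * c + 3) (runConf (.sim q) A (block true (-c) 0) V)
      (runConf .copy A (fun _ => none) fun _ _ => none) := by
  have hhalt : (unaryRuns M).Reach 1 (runConf (.sim q) A (block true (-c) 0) V)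
      (runConf .sweepLeft A (block true (1 - c) 1) fun x => shiftTape (none, 0) (V x)) :=
    reach_runConf (a := (A 0, 0)) (f := (none, -1)) (by simp [unaryRuns, onRunTapes, hq])
      (by simp) (shiftTape_idle rfl)
      (shiftTape_block (block_of_le le_rfl) (by simp; lia) (by simp)) rfl
  have hsweeps := ((hhalt.trans (reach_sweepLeft c A _)).trans (reach_sweepRight c A _)).trans
    (reach_sweepBack c A _)
  refine ⟨_, by convert hsweeps using 1; ring, tickAt_runConf.2 ⟨rfl, rfl⟩, ?_⟩
  rw [next_runConf (q' := .copy) (a := (A 0, 0)) (f := (none, 0)) (v := fun _ => (none, 0))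
    (by simp [unaryRuns, onRunTapes]), shiftTape_idle rfl, shiftTape_blank]
  exact congrArg _ (funext fun x => (hV x).erase_sweeps_eq_blank)

theorem lap_unaryRuns (hM : M.OracleFree) {Z : BinSeq} {j h : ℕ}
    (hh : M.Halted (M.run Z (List.replicate j true) h))
    (hlt : ∀ r < h, ¬ M.Halted (M.run Z (List.replicate j true) r)) :
    ∃ n ≥ h, (unaryRuns M).Lap n
      (runConf .copy (block true 0 j) (fun _ => none) fun _ _ => none)
      (runConf .copy (block true 0 (j + 1 : ℕ)) (fun _ => none) fun _ _ => none) := by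
  have hclear := lap_clear (A := block true 0 (j + 1 : ℕ)) (c := 2 * j + 2 + h)
    ((M.action_eq_view _).symm.trans hh)
    fun x => (M.supportedIn_view_run Z (List.replicate j true) h x).mono
      (by rw [List.length_replicate]; lia) (by rw [List.length_replicate]; lia)
  exact ⟨_, by lia, (reach_sim_start M j).lap ((reach_sim hM hlt).lap hclear)⟩

end UnaryRuns

theorem TimeConstructible.exists_clock {t : ℕ → ℕ} (ht : TimeConstructible t) :
    ∃ (ι : Type) (_ : Finite ι) (E : Clock ι), {s | E.Ticks s}.Infinite ∧
      ∀ s, E.Ticks s → t (Nat.count E.Ticks s) ≤ s := by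
  obtain ⟨M, hM, C, hC⟩ := ht
  let Z : BinSeq := fun _ => false
  have hhalts j : ∃ h, M.Halted (M.run Z (List.replicate j true) h) := ⟨_, (hC j Z).1⟩
  classical
  choose n hn hlap using fun j =>
    lap_unaryRuns hM (Nat.find_spec (hhalts j)) fun _ => Nat.find_min (hhalts j)
  have ht j : t j ≤ n j := by
    have hrun := Machine.run_of_halted (Nat.find_spec (hhalts j)) (Nat.find_min' _ (hC j Z).1)
    have hlen := Machine.length_le_of_tape_numer_run_eq (hrun ▸ (hC j Z).2)
    rw [List.length_replicate] at hlen
    exact hlen.trans (hn j)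
  have h0 : runConf .copy (block true 0 (0 : ℕ)) (fun _ => none) (fun _ _ => none) =
      (unaryRuns M).conf 0 := by
    refine Prod.ext rfl (funext fun x => ?_)
    cases x
    case arg => exact block_eq_blank le_rfl
    all_goals rfl
  let c := fun j : ℕ => runConf (M := M) .copy (block true 0 j) (fun _ => none) fun _ _ => none
  exact ⟨_, inferInstance, unaryRuns M, Clock.infinite_ticks_of_laps (c := c) h0 hlap,
    fun s hs => (ht _).trans (Clock.le_of_laps (c := c) h0 hlap hs)⟩

theorem mul_self_le_two_pow {m : ℕ} (h : 10 ≤ m) : m * m ≤ 2 ^ m := by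
  induction m, h using Nat.le_induction with
  | base => norm_num
  | succ m hm ih => rw [pow_succ]; nlinarith

theorem TimeConstructible.exists_sparse_clock {t : ℕ → ℕ} (ht : TimeConstructible t) :
    ∃ (ι : Type) (_ : Finite ι) (D : Clock ι), {s | D.Ticks s}.Infinite ∧
      ∀ C, ∀ᶠ i in atTop, ∀ n ≤ i + 1, 2 ^ (C * t n + C) ≤ Nat.nth D.Ticks (2 * i) := by
  obtain ⟨ι, _, E, hinf, hE⟩ := ht.exists_clock
  refine ⟨_, inferInstance, E.slow, Clock.infinite_ticks_slow hinf, fun C => ?_⟩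
  filter_upwards [eventually_ge_atTop (2 * C + 10)] with i hi n hn
  set e := Nat.nth E.Ticks (2 * i)
  have hmono := Nat.nth_strictMono hinf
  have hie : 2 * i ≤ e := hmono.le_apply
  have htn : t n ≤ e := by
    have := hE _ (Nat.nth_mem_of_infinite hinf n)
    rw [Nat.count_nth_of_infinite hinf] at this
    exact this.trans (hmono.monotone (by lia))
  have hexp : C * t n + C + 1 ≤ 2 ^ e - 1 := by
    have h1 : C * t n ≤ C * e := Nat.mul_le_mul_left _ htn
    have h2 : C * e + C + 2 ≤ e * e := by nlinarith
    have h3 := mul_self_le_two_pow (m := e) (by lia)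
    lia
  have hpow := (Nat.pow_le_pow_right two_pos hexp).trans (Clock.two_pow_two_pow_nth_le hinf (2 * i))
  have hpos : 0 < 2 ^ (C * t n + C) := by positivity
  rw [pow_succ] at hpow
  lia

/-! ### The martingale that succeeds on the interleaving -/

theorem interleave_two_mul (A B : BinSeq) (n : ℕ) : interleave A B (2 * n) = A n := by
  simp [interleave]

theorem interleave_two_mul_add_one (A B : BinSeq) (n : ℕ) : interleave A B (2 * n + 1) = B n := by
  rw [interleave, if_neg (by lia)]
  congr 1
  lia

/-- The betting strategy for the interleaving of `Y ∘ b` and `Y`, where `b i` is the time of the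
`2i`-th tick of `D`. The first bit of the `i`-th pair and the second bit of the pair number `b i`
agree, and the strategy bets everything on this when it gets to the latter. Only every second tick
is used because then the number of the earlier ticks is the position of the bit to compare with. -/
def pairRatio {ι : Type} (D : Clock ι) (v : List Bool) (a : Bool) : ℝ≥0 :=
  if Odd v.length ∧ D.Ticks (v.length / 2) ∧ Even (Nat.count D.Ticks (v.length / 2)) then
    if a = v.getD (Nat.count D.Ticks (v.length / 2)) false then 2 else 0
  else 1

section PairRatio

variable {ι : Type} {D : Clock ι} {v : List Bool} {p : ℕ}

theorem isFair_pairRatio (D : Clock ι) : IsFair (pairRatio D) := by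
  intro v
  unfold pairRatio
  split_ifs <;> simp_all [one_add_one_eq_two]

theorem pairRatio_of_length_eq_two_mul (h : v.length = 2 * p) (a : Bool) :
    pairRatio D v a = 1 :=
  if_neg fun hv => Nat.not_even_iff_odd.2 hv.1 (h ▸ even_two_mul p)

theorem pairRatio_of_length_eq_two_mul_add_one (h : v.length = 2 * p + 1) (a : Bool) :
    pairRatio D v a = if D.Ticks p ∧ Even (Nat.count D.Ticks p) then
      if a = v.getD (Nat.count D.Ticks p) false then 2 else 0 else 1 := by
  have hp : v.length / 2 = p := by lia
  have hodd : Odd v.length := h ▸ odd_two_mul_add_one p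
  simp only [pairRatio, hp, hodd, true_and]

variable (D) (Y : BinSeq)

theorem pairRatio_pre_interleave (n : ℕ) :
    pairRatio D (pre (interleave (Y ∘ fun i => Nat.nth D.Ticks (2 * i)) Y) (2 * n + 1)) (Y n) =
      if D.Ticks n ∧ Even (Nat.count D.Ticks n) then 2 else 1 := by
  rw [pairRatio_of_length_eq_two_mul_add_one (length_pre _ _)]
  refine if_ctx_congr Iff.rfl (fun ⟨hn, heven⟩ => if_pos ?_) fun _ => rfl
  have hle : Nat.count D.Ticks n ≤ n := Nat.count_le _
  obtain ⟨i, hi⟩ := heven.two_dvd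
  rw [getD_pre _ (by lia), hi, interleave_two_mul, Function.comp_apply, ← hi, Nat.nth_count hn]

theorem capital_pairRatio_pre_interleave (n : ℕ) :
    capital (pairRatio D) (pre (interleave (Y ∘ fun i => Nat.nth D.Ticks (2 * i)) Y) (2 * n)) =
      2 ^ ((Nat.count D.Ticks n + 1) / 2) := by
  induction n with
  | zero => simp
  | succ n ih =>
    rw [mul_add_one, pre_succ, capital_append, interleave_two_mul_add_one,
      pairRatio_pre_interleave, pre_succ, capital_append, ih,
      pairRatio_of_length_eq_two_mul (length_pre _ _), mul_one, Nat.count_succ]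
    by_cases hn : D.Ticks n
    · rcases Nat.even_or_odd (Nat.count D.Ticks n) with heven | hodd
      · rw [if_pos ⟨hn, heven⟩, if_pos hn, ← pow_succ]
        congr 1
        obtain ⟨i, hi⟩ := heven
        lia
      · rw [if_neg fun h => Nat.not_even_iff_odd.2 hodd h.2, if_pos hn, mul_one]
        congr 1
        obtain ⟨i, hi⟩ := hodd
        lia
    · rw [if_neg fun h => hn h.1, if_neg hn, mul_one, add_zero]

variable {D}

theorem succeeds_pairRatio (hD : {s | D.Ticks s}.Infinite) :
    Succeeds (capital (pairRatio D)) (interleave (Y ∘ fun i => Nat.nth D.Ticks (2 * i)) Y) := by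
  have hmono : StrictMono fun n => 2 * Nat.nth D.Ticks (2 * n) := fun m n h =>
    Nat.mul_lt_mul_of_pos_left (Nat.nth_strictMono hD (by lia)) two_pos
  refine succeeds_of_tendsto hmono.tendsto_atTop ?_
  have hexp : ∀ n, (2 * n + 1) / 2 = n := by lia
  simp only [capital_pairRatio_pre_interleave, Nat.count_nth_of_infinite hD, hexp]
  exact tendsto_pow_atTop_atTop_of_one_lt one_lt_two

end PairRatio

/-! ### A machine for this martingale -/

/-- The states of the machine for `pairRatio D`, where `Q` are the states of `D`: it copies the
input, takes the heads back, and then runs `D` at one step for each pair of bits of the input, with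
the following flags: `odd`, if the next bit is the second one of a pair; `alive`, if no bet has been
lost; `bet`, if `D` has ticked an even number of times. -/
inductive ScanState (Q : Type) : Type
  | copying
  | rewinding
  | scan (odd alive bet : Bool) (q : Q)
  | done

instance (Q : Type) [Finite Q] : Finite (ScanState Q) :=
  Finite.of_surjective
    (Sum.elim ![.copying, .rewinding, .done] fun s => .scan s.1 s.2.1 s.2.2.1 s.2.2.2 :
      Fin 3 ⊕ Bool × Bool × Bool × Q → _)
    fun
    | .copying => ⟨.inl 0, rfl⟩
    | .rewinding => ⟨.inl 1, rfl⟩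
    | .done => ⟨.inl 2, rfl⟩
    | .scan odd alive bet q => ⟨.inr (odd, alive, bet, q), rfl⟩

/-- What the machine for `pairRatio D` does in a step before the last one: the new state, the move
on the input tape, the operation on the copy of the input, whether `0` is appended to the numerator,
and the operations on the tapes of `D`. -/
structure ScanMove (ι Q : Type) where
  state : ScanState Q
  input : SignType
  copy : TapeOp
  push : Bool
  ops : ι → TapeOp

section Scan

variable {ι : Type} (D : Clock ι)

/-- The step that the machine for `pairRatio D` makes in the state `q` when it reads `b` on the
input tape, `a` on its copy and `v` on the tapes of `D`; `none` if this is not a step before the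
last one. The head on the copy advances when `D` ticks, so that its position is the number of
ticks. -/
def scanMove (q : ScanState D.Q) (b a : Option Bool) (v : ι → Option Bool) :
    Option (ScanMove ι D.Q) :=
  match q with
  | .copying =>
    if b.isSome then some ⟨.copying, 1, (b, 1), false, fun x => (v x, 0)⟩
    else some ⟨.rewinding, -1, (a, -1), false, fun x => (v x, 0)⟩
  | .rewinding =>
    if b.isSome then some ⟨.rewinding, -1, (a, -1), false, fun x => (v x, 0)⟩
    else some ⟨.scan false true true D.start, 1, (a, 1), false, fun x => (v x, 0)⟩
  | .scan odd alive bet q =>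
    if b.isSome then
      if odd then
        if D.tick q v then
          some ⟨.scan false (alive && (!bet || b == a)) (!bet) (D.δ q v).1, 1, (a, 1),
            bet && b == a, (D.δ q v).2⟩
        else some ⟨.scan false alive bet (D.δ q v).1, 1, (a, 0), false, (D.δ q v).2⟩
      else some ⟨.scan true alive bet q, 1, (a, 0), false, fun x => (v x, 0)⟩
    else none
  | .done => none

variable {k : ℕ} (e : Fin k ≃ Option ι)

/-- The operations that make up the step `m` when the symbols `r` are read. The work tapes are
identified by `e` with the copy of the input and the tapes of `D`. -/
def scanOps (m : ScanMove ι D.Q) (r : TapeName k → Option Bool) : TapeName k → TapeOp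
  | .input => (r .input, m.input)
  | .query => (r .query, 0)
  | .numer => if m.push then (some false, 1) else (r .numer, 0)
  | .denom => (r .denom, 0)
  | .work i => (e i).elim m.copy m.ops

/-- The operations of the last step when the symbols `r` are read: they make the denominator `1` and
the numerator a power of `2`, or `0` if a bet has been lost. -/
def finishOps (alive : Bool) (r : TapeName k → Option Bool) : TapeName k → TapeOp
  | .numer => (if alive then some true else r .numer, 0)
  | .denom => (some true, 0)
  | x => (r x, 0)

/-- A machine that computes the martingale `capital (pairRatio D)`. -/
def scanMachine : Machine where
  k := k
  Q := ScanState D.Q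
  finite_states := by
    have := D.finite_states
    infer_instance
  start := .copying
  δ q r :=
    match scanMove D q (r .input) (r (.work (e.symm none)))
      fun x => r (.work (e.symm (some x))), q with
    | some m, _ => .act m.state (scanOps D e m r)
    | none, .scan _ alive _ _ => .act .done (finishOps alive r)
    | none, _ => .halt

theorem oracleFree_scanMachine : (scanMachine D e).OracleFree := by
  intro q r next h
  simp only [scanMachine] at h
  split at h <;> cases h

/-- The configurations before the last step: the state is `q`, the heads on the input and its copy
are in the positions `i` and `p`, the copy is `T`, the numerator consists of `z` zeros, and `V` are
the tapes of `D`. -/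
structure ScanAt (w : List Bool) (c : Config (scanMachine D e)) (q : ScanState D.Q) (i : ℤ)
    (T : TapeContent) (p : ℤ) (z : ℕ) (V : ι → TapeContent) : Prop where
  state : c.state = q
  input_tape : c.tape .input = tapeOf w
  input_head : c.head .input = i
  numer_tape : c.tape .numer = block false 0 z
  numer_head : c.head .numer = z
  denom_tape : c.tape .denom = fun _ => none
  denom_head : c.head .denom = 0
  copy_tape : c.tape (.work (e.symm none)) = T
  copy_head : c.head (.work (e.symm none)) = p
  view : ∀ x, c.view (.work (e.symm (some x))) = V x

variable {D e} {w : List Bool} {Z : BinSeq} {c : Config (scanMachine D e)} {q : ScanState D.Q}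
  {i i' p p' : ℤ} {T : TapeContent} {n z : ℕ} {V V' : ι → TapeContent}

theorem update_block (s : Bool) (z : ℕ) :
    Function.update (block s 0 z) z (some s) = block s 0 (z + 1 : ℕ) := by
  funext i
  simp only [block, Function.update_apply]
  split_ifs <;> first | rfl | lia

theorem ScanAt.scanMove_eq (h : ScanAt D e w c q i T p z V) :
    scanMove D c.state (c.tape .input (c.head .input))
      (c.tape (.work (e.symm none)) (c.head (.work (e.symm none))))
      (fun x => c.tape (.work (e.symm (some x))) (c.head (.work (e.symm (some x))))) =
    scanMove D q (tapeOf w i) (T p) fun x => V x 0 := by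
  rw [h.state, h.input_tape, h.input_head, h.copy_tape, h.copy_head]
  congr 1
  funext x
  rw [← h.view x, Config.view, add_zero]

theorem scanMachine_δ_of_eq_some {q : ScanState D.Q} {r : TapeName k → Option Bool}
    {m : ScanMove ι D.Q} (h : scanMove D q (r .input) (r (.work (e.symm none)))
      (fun x => r (.work (e.symm (some x)))) = some m) :
    (scanMachine D e).δ q r = .act m.state (scanOps D e m r) := by
  simp only [scanMachine, h]

theorem scanMachine_δ_of_eq_none {odd alive bet : Bool} {q : D.Q} {r : TapeName k → Option Bool}
    (h : scanMove D (.scan odd alive bet q) (r .input) (r (.work (e.symm none)))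
      (fun x => r (.work (e.symm (some x)))) = none) :
    (scanMachine D e).δ (.scan odd alive bet q) r = .act .done (finishOps alive r) := by
  simp only [scanMachine, h]

theorem scanOps_work_symm (m : ScanMove ι D.Q) (r : TapeName k → Option Bool) (x : Option ι) :
    scanOps D e m r (.work (e.symm x)) = x.elim m.copy m.ops := by
  simp [scanOps]

theorem ScanAt.step (h : ScanAt D e w c q i T p z V) {m : ScanMove ι D.Q}
    (hm : scanMove D q (tapeOf w i) (T p) (fun x => V x 0) = some m) :
    ScanAt D e w ((scanMachine D e).step Z c) m.state (i + m.input)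
      (Function.update T p m.copy.1) (p + m.copy.2) (if m.push then z + 1 else z)
      fun x => shiftTape (m.ops x) (V x) := by
  have hact : (scanMachine D e).action c =
      .act m.state (scanOps D e m fun j => c.tape j (c.head j)) :=
    scanMachine_δ_of_eq_some (r := fun j => c.tape j (c.head j)) (h.scanMove_eq.trans hm)
  have hview := Machine.view_step (Z := Z) hact
  have hcopy := scanOps_work_symm (e := e) m (fun j => c.tape j (c.head j)) none
  have hclock := fun x => scanOps_work_symm (e := e) m (fun j => c.tape j (c.head j)) (some x)
  rw [Machine.step_of_act hact] at hview ⊢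
  constructor
  case state => rfl
  case input_tape => simp [scanOps, h.input_tape]
  case input_head => simp [scanOps, h.input_head]
  case numer_tape =>
    cases hpush : m.push <;> simp [scanOps, hpush, h.numer_tape, h.numer_head, update_block]
  case numer_head => cases hpush : m.push <;> simp [scanOps, hpush, h.numer_head]
  case denom_tape => simp [scanOps, h.denom_tape]
  case denom_head => simp [scanOps, h.denom_head]
  case copy_tape =>
    rw [← h.copy_tape, ← h.copy_head]
    exact congrArg (Function.update _ _) (congrArg Prod.fst hcopy)
  case copy_head =>
    rw [← h.copy_head]
    exact congrArg (fun op : TapeOp => _ + (op.2 : ℤ)) hcopy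
  case view =>
    intro x
    exact (congrFun hview _).trans (congrArg₂ shiftTape (hclock x) (h.view x))

theorem ScanAt.step_of_write_eq (h : ScanAt D e w c q i T p z V) {q' : ScanState D.Q}
    {a b : SignType} {push : Bool} {ops : ι → TapeOp}
    (hm : scanMove D q (tapeOf w i) (T p) (fun x => V x 0) = some ⟨q', a, (T p, b), push, ops⟩)
    (hi : i + a = i') (hp : p + b = p') (hV : ∀ x, shiftTape (ops x) (V x) = V' x) :
    ScanAt D e w ((scanMachine D e).step Z c) q' i' T p' (if push then z + 1 else z) V' := by
  obtain rfl : (fun x => shiftTape (ops x) (V x)) = V' := funext hV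
  subst hi hp
  simpa using h.step (Z := Z) hm

theorem tapeOf_of_lt (h : n < w.length) : tapeOf w n = some (w.getD n false) := by
  simp [tapeOf, h, List.getD_eq_getElem?_getD]

theorem isSome_tapeOf_of_lt (h : n < w.length) : (tapeOf w n).isSome := by
  simp [tapeOf_of_lt h]

theorem tapeOf_of_neg (h : i < 0) : tapeOf w i = none :=
  if_neg h.not_ge

theorem tapeOf_length (w : List Bool) : tapeOf w w.length = none := by
  simp [tapeOf]

theorem update_tapeOf_take (w : List Bool) (n : ℕ) :
    Function.update (tapeOf (w.take n)) n (tapeOf w n) = tapeOf (w.take (n + 1)) := by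
  funext i
  rcases lt_or_ge i 0 with hi | hi
  · rw [Function.update_of_ne (by lia), tapeOf_of_neg hi, tapeOf_of_neg hi]
  · obtain ⟨m, rfl⟩ := Int.eq_ofNat_of_zero_le hi
    simp only [Function.update_apply, tapeOf, List.getElem?_take, Int.natCast_nonneg, if_true,
      Int.toNat_natCast, Nat.cast_inj]
    grind

variable (D e w Z)

theorem scanAt_copying (hn : n ≤ w.length) :
    ScanAt D e w ((scanMachine D e).run Z w n) .copying n (tapeOf (w.take n)) n 0
      fun _ _ => none := by
  induction n with
  | zero =>
    constructor
    case numer_tape => exact (block_eq_blank le_rfl).symm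
    case copy_tape => exact (tapeOf_replicate false 0).trans (block_eq_blank le_rfl) |>.symm
    case view => exact fun _ => rfl
    all_goals rfl
  | succ n ih =>
    rw [Machine.run_succ]
    have hstep := (ih (by lia)).step (Z := Z) (m := ⟨.copying, 1, (tapeOf w n, 1), false, _⟩)
      (if_pos (isSome_tapeOf_of_lt hn))
    simpa [update_tapeOf_take, shiftTape_blank] using hstep

theorem scanAt_rewinding (hn : n ≤ w.length) :
    ScanAt D e w ((scanMachine D e).run Z w (w.length + 1 + n)) .rewinding (w.length - 1 - n)
      (tapeOf w) (w.length - 1 - n) 0 fun _ _ => none := by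
  induction n with
  | zero =>
    have hcopied := scanAt_copying D e w Z le_rfl
    rw [List.take_length] at hcopied
    rw [add_zero, Machine.run_succ]
    exact hcopied.step_of_write_eq (push := false) (by rw [scanMove, tapeOf_length]; rfl)
      (by simp; lia) (by simp; lia) fun _ => shiftTape_blank 0
  | succ n ih =>
    have hisSome : (tapeOf w (w.length - 1 - n)).isSome := by
      rw [show (w.length - 1 - n : ℤ) = (w.length - 1 - n : ℕ) by lia]
      exact isSome_tapeOf_of_lt (by lia)
    rw [← add_assoc, Machine.run_succ]
    exact (ih (by lia)).step_of_write_eq (push := false) (if_pos hisSome)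
      (by simp; lia) (by simp; lia) fun _ => shiftTape_blank 0

theorem scanAt_start :
    ScanAt D e w ((scanMachine D e).run Z w (2 * w.length + 2)) (.scan false true true D.start) 0
      (tapeOf w) 0 0 fun _ _ => none := by
  have hrewound := scanAt_rewinding D e w Z le_rfl
  rw [show 2 * w.length + 2 = w.length + 1 + w.length + 1 by ring, Machine.run_succ]
  exact hrewound.step_of_write_eq (push := false)
    (by rw [scanMove, tapeOf_of_neg (by lia)]; rfl) (by simp) (by simp) fun _ => shiftTape_blank 0

/-- The invariant of the scan, after `n` pairs of bits and, if `odd` holds, one further bit: the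
numerator consists of `z` zeros where `2 ^ z` is the capital, unless all of it has been lost. -/
def ScanInv (n : ℕ) (odd : Bool) (c : Config (scanMachine D e)) : Prop :=
  ∃ (alive : Bool) (z : ℕ),
    ScanAt D e w c
      (.scan odd alive (decide (Even (Nat.count D.Ticks n))) (D.conf n).1)
      ((2 * n + odd.toNat : ℕ) : ℤ) (tapeOf w) (Nat.count D.Ticks n) z (D.conf n).2 ∧
    capital (pairRatio D) (w.take (2 * n + odd.toNat)) = if alive then 2 ^ z else 0

variable {D e w Z}

theorem capital_take_add_one (ρ : List Bool → Bool → ℝ≥0) (hn : n < w.length) :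
    capital ρ (w.take (n + 1)) = capital ρ (w.take n) * ρ (w.take n) (w.getD n false) := by
  rw [List.take_add_one, ← capital_append, List.getElem?_eq_getElem hn,
    List.getD_eq_getElem _ _ hn, Option.toList_some]

theorem capital_pairRatio_take_two_mul_add_one (hn : 2 * n < w.length) :
    capital (pairRatio D) (w.take (2 * n + 1)) = capital (pairRatio D) (w.take (2 * n)) := by
  rw [capital_take_add_one _ hn,
    pairRatio_of_length_eq_two_mul (List.length_take_of_le hn.le), mul_one]

theorem capital_pairRatio_take_two_mul_add_two (hn : 2 * n + 1 < w.length) :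
    capital (pairRatio D) (w.take (2 * n + 2)) = capital (pairRatio D) (w.take (2 * n + 1)) *
      if D.Ticks n ∧ Even (Nat.count D.Ticks n) then
        if w.getD (2 * n + 1) false = w.getD (Nat.count D.Ticks n) false then 2 else 0
      else 1 := by
  have hcount : Nat.count D.Ticks n < 2 * n + 1 := (Nat.count_le _).trans_lt (by lia)
  have hgetD : (w.take (2 * n + 1)).getD (Nat.count D.Ticks n) false =
      w.getD (Nat.count D.Ticks n) false := by
    simp only [List.getD_eq_getElem?_getD, List.getElem?_take_of_lt hcount]
  rw [capital_take_add_one _ hn,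
    pairRatio_of_length_eq_two_mul_add_one (List.length_take_of_le hn.le), hgetD]

theorem ScanInv.step_false (h : ScanInv D e w n false c) (hn : 2 * n < w.length) :
    ScanInv D e w n true ((scanMachine D e).step Z c) := by
  obtain ⟨alive, z, hat, hcap⟩ := h
  refine ⟨alive, z, ?_, (capital_pairRatio_take_two_mul_add_one hn).trans hcap⟩
  exact hat.step_of_write_eq (push := false) (b := 0) (a := 1)
    ((if_pos (isSome_tapeOf_of_lt hn)).trans (if_neg Bool.false_ne_true)) (by simp) (by simp)
    fun _ => shiftTape_idle rfl

theorem ScanInv.step_true_of_not_ticks (h : ScanInv D e w n true c) (hn : 2 * n + 1 < w.length)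
    (htick : ¬ D.Ticks n) : ScanInv D e w (n + 1) false ((scanMachine D e).step Z c) := by
  obtain ⟨alive, z, hat, hcap⟩ := h
  have hcap' := capital_pairRatio_take_two_mul_add_two (D := D) hn
  rw [if_neg fun h => htick h.1, mul_one] at hcap'
  rw [ScanInv, D.conf_succ, Nat.count_succ, if_neg htick, add_zero]
  refine ⟨alive, z, ?_, hcap'.trans hcap⟩
  exact hat.step_of_write_eq (push := false) (b := 0) (a := 1)
    ((if_pos (isSome_tapeOf_of_lt hn)).trans ((if_pos rfl).trans (if_neg htick)))
    (by simp; ring) (by simp) fun _ => rfl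

theorem ScanInv.step_true_of_ticks (h : ScanInv D e w n true c) (hn : 2 * n + 1 < w.length)
    (htick : D.Ticks n) : ScanInv D e w (n + 1) false ((scanMachine D e).step Z c) := by
  obtain ⟨alive, z, hat, hcap⟩ := h
  have hcount : Nat.count D.Ticks n < w.length := (Nat.count_le _).trans_lt (by lia)
  have hflag : decide (Even (Nat.count D.Ticks n + 1)) = !decide (Even (Nat.count D.Ticks n)) := by
    rw [decide_eq_decide.2 Nat.even_add_one, decide_not]
  rw [ScanInv, D.conf_succ, Nat.count_succ, if_pos htick, hflag]
  refine ⟨_, _, hat.step_of_write_eq (b := 1) (a := 1)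
    ((if_pos (isSome_tapeOf_of_lt hn)).trans ((if_pos rfl).trans (if_pos htick)))
    (by simp; ring) (by simp) fun _ => rfl, ?_⟩
  refine (capital_pairRatio_take_two_mul_add_two hn).trans ?_
  rw [show w.take (2 * n + 1) = w.take (2 * n + true.toNat) from rfl, hcap, Bool.toNat_true,
    tapeOf_of_lt hn, tapeOf_of_lt hcount]
  by_cases heven : Even (Nat.count D.Ticks n) <;>
    by_cases hbits : w.getD (2 * n + 1) false = w.getD (Nat.count D.Ticks n) false <;>
    cases alive <;> simp [htick, heven, hbits, pow_succ, -List.getD_eq_getElem?_getD]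

theorem ScanInv.step_true (h : ScanInv D e w n true c) (hn : 2 * n + 1 < w.length) :
    ScanInv D e w (n + 1) false ((scanMachine D e).step Z c) := by
  by_cases htick : D.Ticks n
  · exact h.step_true_of_ticks hn htick
  · exact h.step_true_of_not_ticks hn htick

variable (D e w Z)

theorem scanInv_run (hn : 2 * n ≤ w.length) :
    ScanInv D e w n false ((scanMachine D e).run Z w (2 * w.length + 2 + 2 * n)) := by
  induction n with
  | zero => exact ⟨true, 0, scanAt_start D e w Z, rfl⟩
  | succ n ih =>
    rw [mul_add_one, ← add_assoc, Machine.run_succ, Machine.run_succ]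
    exact ((ih (by lia)).step_false (by lia)).step_true (by lia)

theorem exists_scanAt_length : ∃ odd alive bet q p z V,
    ScanAt D e w ((scanMachine D e).run Z w (3 * w.length + 2)) (.scan odd alive bet q) w.length
      (tapeOf w) p z V ∧ capital (pairRatio D) w = if alive then 2 ^ z else 0 := by
  suffices h : ∃ n odd, 2 * n + odd.toNat = w.length ∧
      ScanInv D e w n odd ((scanMachine D e).run Z w (3 * w.length + 2)) by
    obtain ⟨n, odd, hn, alive, z, hat, hcap⟩ := h
    rw [hn] at hat hcap
    exact ⟨odd, alive, _, _, _, z, _, hat, by rwa [List.take_length] at hcap⟩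
  rcases Nat.even_or_odd' w.length with ⟨n, hn | hn⟩
  · refine ⟨n, false, hn.symm, ?_⟩
    rw [show 3 * w.length + 2 = 2 * w.length + 2 + 2 * n by lia]
    exact scanInv_run D e w Z hn.ge
  · refine ⟨n, true, hn.symm, ?_⟩
    rw [show 3 * w.length + 2 = 2 * w.length + 2 + 2 * n + 1 by lia, Machine.run_succ]
    exact (scanInv_run D e w Z (by lia)).step_false (by lia)

variable {D e w Z}

theorem ScanAt.action_of_length {odd alive bet : Bool} {q : D.Q}
    (h : ScanAt D e w c (.scan odd alive bet q) w.length T p z V) :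
    (scanMachine D e).action c = .act .done (finishOps alive fun j => c.tape j (c.head j)) := by
  have hmove := h.scanMove_eq
  rw [tapeOf_length, h.state] at hmove
  rw [Machine.action, h.state]
  exact scanMachine_δ_of_eq_none (r := fun j => c.tape j (c.head j)) hmove

theorem blockLength_eq (h : T n = none) (h' : ∀ i < n, T (i : ℤ) ≠ none) : blockLength T = n :=
  (blockLength_le h).antisymm <| le_csInf ⟨n, h⟩ fun i hi => not_lt.1 fun hlt => h' i hlt hi

theorem binaryValue_block_false (z : ℕ) : binaryValue (block false 0 z) = 0 := by
  refine Finset.sum_eq_zero fun i _ => if_neg ?_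
  rw [block]
  split_ifs <;> simp

theorem binaryValue_update_block_false (z : ℕ) :
    binaryValue (Function.update (block false 0 z) z (some true)) = 2 ^ z := by
  have hlen : blockLength (Function.update (block false 0 z) z (some true)) = z + 1 := by
    refine blockLength_eq ?_ fun i hi => ?_
    · rw [Function.update_of_ne (by lia), block_of_le (by lia)]
    · rcases (Nat.lt_succ_iff.1 hi).eq_or_lt with rfl | hlt
      · simp
      · simp [hlt.ne, block_of_mem (Int.natCast_nonneg i) (Int.ofNat_lt.2 hlt)]
  have hzero : ∀ i ∈ Finset.range z,
      (if Function.update (block false 0 z) z (some true) (i : ℤ) = some true then 2 ^ i else 0)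
        = 0 := fun i hi => by
    have hlt := Finset.mem_range.1 hi
    simp [hlt.ne, block_of_mem (Int.natCast_nonneg i) (Int.ofNat_lt.2 hlt)]
  rw [binaryValue, hlen, Finset.sum_range_succ, Finset.sum_eq_zero hzero]
  simp

theorem ScanAt.halted_step {odd alive bet : Bool} {q : D.Q}
    (h : ScanAt D e w c (.scan odd alive bet q) w.length T p z V) :
    (scanMachine D e).Halted ((scanMachine D e).step Z c) := by
  rw [Machine.step_of_act h.action_of_length]
  rfl

theorem ScanAt.binaryValue_denom {odd alive bet : Bool} {q : D.Q}
    (h : ScanAt D e w c (.scan odd alive bet q) w.length T p z V) :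
    binaryValue (((scanMachine D e).step Z c).tape .denom) = 1 := by
  rw [Machine.step_of_act h.action_of_length]
  have hdenom := binaryValue_update_block_false 0
  rw [block_eq_blank (by simp)] at hdenom
  simpa [finishOps, h.denom_tape, h.denom_head] using hdenom

theorem ScanAt.binaryValue_numer {odd alive bet : Bool} {q : D.Q}
    (h : ScanAt D e w c (.scan odd alive bet q) w.length T p z V) :
    binaryValue (((scanMachine D e).step Z c).tape .numer) = if alive then 2 ^ z else 0 := by
  rw [Machine.step_of_act h.action_of_length]
  cases alive <;> simp [finishOps, h.numer_tape, h.numer_head, binaryValue_block_false,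
    binaryValue_update_block_false]

variable (D e w Z)

theorem scanMachine_outputsWithin :
    (scanMachine D e).OutputsWithin Z w (3 * w.length + 3) (capital (pairRatio D) w) := by
  obtain ⟨odd, alive, bet, q, p, z, V, hat, hcap⟩ := exists_scanAt_length D e w Z
  rw [Machine.OutputsWithin, Machine.run_succ, hat.binaryValue_denom, hat.binaryValue_numer, hcap]
  exact ⟨hat.halted_step, one_ne_zero, by cases alive <;> simp⟩

end Scan

theorem exists_le_mul_add_of_isBigO {f g : ℕ → ℕ}
    (h : (fun n => (f n : ℝ)) =O[atTop] fun n => (g n : ℝ)) : ∃ C, ∀ n, f n ≤ C * g n + C := by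
  obtain ⟨c, hc⟩ := h.bound
  obtain ⟨N, hN⟩ := eventually_atTop.1 hc
  obtain ⟨K, hK⟩ := ((Set.finite_lt_nat N).image f).bddAbove
  refine ⟨max ⌈c⌉₊ K, fun n => ?_⟩
  rcases lt_or_ge n N with hn | hn
  · calc f n ≤ K := hK ⟨n, hn, rfl⟩
      _ ≤ max ⌈c⌉₊ K * g n + max ⌈c⌉₊ K := (le_max_right _ _).trans le_add_self
  · have hfg : (f n : ℝ) ≤ ⌈c⌉₊ * g n := by
      simpa using (hN n hn).trans
        (mul_le_mul_of_nonneg_right (Nat.le_ceil c) (norm_nonneg _))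
    calc f n ≤ ⌈c⌉₊ * g n := mod_cast hfg
      _ ≤ max ⌈c⌉₊ K * g n := Nat.mul_le_mul_right _ (le_max_left _ _)
      _ ≤ max ⌈c⌉₊ K * g n + max ⌈c⌉₊ K := le_self_add

theorem isBoundedMartingale_pairRatio {ι : Type} [Finite ι] (D : Clock ι) {t : ℕ → ℕ}
    (ht : (fun n : ℕ => (n : ℝ)) =O[atTop] fun n => (t n : ℝ)) :
    IsBoundedMartingale t (capital (pairRatio D)) := by
  obtain ⟨k, ⟨e⟩⟩ := Finite.exists_equiv_fin (Option ι)
  obtain ⟨C, hC⟩ := exists_le_mul_add_of_isBigO ht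
  refine ⟨(isFair_pairRatio D).isMartingale_capital, scanMachine D e.symm,
    oracleFree_scanMachine D e.symm, 3 * C + 3, fun w Z => ?_⟩
  exact (scanMachine_outputsWithin D e.symm w Z).mono (by nlinarith [hC w.length])

end TimeBounded

end

theorem mainTheorem1_general {t T : ℕ → ℕ}
    (ht : (fun n : ℕ => (n : ℝ)) =O[atTop] fun n => (t n : ℝ))
    (hT : TimeBounded.TimeConstructible T)
    (htT : (fun n => (t n : ℝ)) =O[atTop] fun n => (T n : ℝ)) :
    ∃ A B : TimeBounded.BinSeq,
      TimeBounded.IsRandom t B ∧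
      TimeBounded.IsRandomRel t B A ∧
      ¬ TimeBounded.IsRandom t (TimeBounded.interleave A B) := by
  obtain ⟨ι, hι, D, hinf, hgrow⟩ := hT.exists_sparse_clock
  obtain ⟨K, hK⟩ := TimeBounded.exists_le_mul_add_of_isBigO htT
  have hmono : StrictMono fun i => Nat.nth D.Ticks (2 * i) :=
    (Nat.nth_strictMono hinf).comp (strictMono_mul_left_of_pos two_pos)
  obtain ⟨Y, hY, hYb⟩ := TimeBounded.exists_isRandom_isRandomRel_comp (t := t) hmono fun C => by
    filter_upwards [hgrow (C * K + C)] with i hi n hn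
    exact (Nat.pow_le_pow_right two_pos (by nlinarith [hK n])).trans (hi n hn)
  exact ⟨_, Y, hY, hYb, fun hrandom => hrandom
    ⟨_, TimeBounded.isBoundedMartingale_pairRatio D ht, TimeBounded.succeeds_pairRatio Y hinf⟩⟩

theorem mainTheorem1 (t : ℕ → ℕ) (ht : TimeBounded.Superlinear t)
    (hc : TimeBounded.TimeConstructible t) :
    ∃ A B : TimeBounded.BinSeq,
      TimeBounded.IsRandom t B ∧
      TimeBounded.IsRandomRel t B A ∧
      ¬ TimeBounded.IsRandom t (TimeBounded.interleave A B) :=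
  mainTheorem1_general ht.isBigO hc (Asymptotics.isBigO_refl _ _)
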